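/- Let $(M,g)$ be a smooth connected semi-Riemannian manifold of dimension $n\ge 3$, with curvature operator $R(X,Y)=[\nabla_X,\nabla_Y]-\nabla_{[X,Y]}$ of the Levi-Civita connection, curvature tensor $R(X_1,X_2,X_3,X_4)=g(R(X_1,X_2)X_3,X_4)$, Ricci tensor $S(Y,Z)=\operatorname{tr}(X\mapsto R(X,Y)Z)$ and scalar curvature $\kappa=\operatorname{tr}_g S$. For symmetric $(0,2)$-tensors $A,B$ put $$(A\wedge B)(X_1,X_2,X_3,X_4)=A(X_1,X_4)B(X_2,X_3)+A(X_2,X_3)B(X_1,X_4)-A(X_1,X_3)B(X_2,X_4)-A(X_2,X_4)B(X_1,X_3),$$ and let $$C=R-\frac{1}{n-2}\,g\wedge S+\frac{\kappa}{2(n-1)(n-2)}\,g\wedge g$$ be the Weyl conformal curvature tensor. For an endomorphism $\mathcal H$ and a $(0,k)$-tensor $T$ let $(\mathcal H T)(X_1,\dots,X_k)=-\sum_{i=1}^k T(X_1,\dots,\mathcal H X_i,\dots,X_k)$, and define the $(0,k+2)$-tensors $$(R\cdot T)(X_1,\dots,X_k;X,Y)=(R(X,Y)\,T)(X_1,\dots,X_k),\qquad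 Q(A,T)(X_1,\dots,X_k;X,Y)=((X\wedge_A Y)\,T)(X_1,\dots,X_k),$$ where $(X\wedge_A Y)Z=A(Y,Z)X-A(X,Z)Y$. Let $U_S=\{x\in M: S-\frac{\kappa}{n}g\neq 0 \text{ at } x\}$. Let $L_S,L_1,L_2$ be real-valued functions on $M$. Suppose that $M$ is Ricci pseudosymmetric, i.e. $R\cdot S=L_S\,Q(g,S)$ on $U_S$, and that $$R\cdot R-Q(S,R)=L_1\,Q(g,C)\qquad\text{and}\qquad R\cdot C=L_2\,Q(S,C)\qquad\text{on } M.$$ Then at every point $x\in U_S$ at which $L_1(x)\neq 0$ or $L_2(x)\neq 1$, the pseudosymmetry condition $R\cdot R=L_S\,Q(g,R)$ holds. In particular, if at every point of $U_S$ one has $L_1\ne 0$ or $L_2\ne 1$, then $R\cdot R=L_S\,Q(g,R)$ holds on $U_S$. -/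

import Mathlib

set_option maxSynthPendingDepth 3

open scoped Manifold ContDiff

noncomputable section

/-! ## Tensor algebra on one tangent space -/

namespace TensorAlg

variable {V : Type*} [AddCommGroup V] [Module ℝ V]

/-- The action of an endomorphism `H` as a derivation on a `(0,k)`-tensor `T`:
`(H T)(X₁, …, X_k) = - T(H X₁, X₂, …, X_k) - ⋯ - T(X₁, …, X_{k-1}, H X_k)`. -/
def act (H : V → V) {k : ℕ} (T : (Fin k → V) → ℝ) (v : Fin k → V) : ℝ :=
  -∑ i, T (Function.update v i (H (v i)))

/-- The endomorphism `X ∧_A Y` : `Z ↦ A(Y, Z) X - A(X, Z) Y`. -/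
def wedgeEnd (A : V →ₗ[ℝ] V →ₗ[ℝ] ℝ) (X Y Z : V) : V := A Y Z • X - A X Z • Y

/-- The `(0,k+2)`-tensor `D · T`, `(D · T)(X₁, …, X_k; X, Y) = (D(X, Y) T)(X₁, …, X_k)`, where
`D` is a `(1,3)`-tensor, `D X Y Z = D(X, Y) Z`. -/
def dot (D : V →ₗ[ℝ] V →ₗ[ℝ] V →ₗ[ℝ] V) {k : ℕ} (T : (Fin k → V) → ℝ)
    (v : Fin k → V) (X Y : V) : ℝ :=
  act (fun Z => D X Y Z) T v

/-- The `(0,k+2)`-tensor `Q(A, T)`,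
`Q(A, T)(X₁, …, X_k; X, Y) = ((X ∧_A Y) T)(X₁, …, X_k)`. -/
def Q (A : V →ₗ[ℝ] V →ₗ[ℝ] ℝ) {k : ℕ} (T : (Fin k → V) → ℝ)
    (v : Fin k → V) (X Y : V) : ℝ :=
  act (wedgeEnd A X Y) T v

/-- A bilinear form as a function on pairs of vectors, so that `dot` and `Q` apply to it. -/
def tensor₂ (A : V →ₗ[ℝ] V →ₗ[ℝ] ℝ) (v : Fin 2 → V) : ℝ := A (v 0) (v 1)

/-- The `(0,4)`-tensor `g(D(X₁, X₂) X₃, X₄)` of a `(1,3)`-tensor `D`. -/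
def lower (g : V →ₗ[ℝ] V →ₗ[ℝ] ℝ) (D : V →ₗ[ℝ] V →ₗ[ℝ] V →ₗ[ℝ] V) (v : Fin 4 → V) : ℝ :=
  g (D (v 0) (v 1) (v 2)) (v 3)

/-- The Kulkarni–Nomizu product of two `(0,2)`-tensors. -/
def kn (A B : V →ₗ[ℝ] V →ₗ[ℝ] ℝ) (v : Fin 4 → V) : ℝ :=
  A (v 0) (v 3) * B (v 1) (v 2) + A (v 1) (v 2) * B (v 0) (v 3)
    - A (v 0) (v 2) * B (v 1) (v 3) - A (v 1) (v 3) * B (v 0) (v 2)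

/-- The Ricci contraction `S(Y, Z) = trace (X ↦ D(X, Y) Z)` of a `(1,3)`-tensor `D`. -/
def ricci (D : V →ₗ[ℝ] V →ₗ[ℝ] V →ₗ[ℝ] V) : V →ₗ[ℝ] V →ₗ[ℝ] ℝ :=
  LinearMap.mk₂ ℝ (fun Y Z => LinearMap.trace ℝ V ((D.flip Y).flip Z))
    (fun Y Y' Z => by
      rw [← map_add]; congr 1; ext X; simp)
    (fun c Y Z => by
      rw [← map_smul]; congr 1; ext X; simp)
    (fun Y Z Z' => by
      rw [← map_add]; congr 1; ext X; simp)
    (fun c Y Z => by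
      rw [← map_smul]; congr 1; ext X; simp)

/-- The trace of a bilinear form `A` with respect to a nondegenerate form `g`: the trace of the
endomorphism `𝒜` determined by `g(𝒜 X, Y) = A(X, Y)`. -/
def traceForm [FiniteDimensional ℝ V] (g : LinearMap.BilinForm ℝ V) (hg : g.Nondegenerate)
    (A : V →ₗ[ℝ] V →ₗ[ℝ] ℝ) : ℝ :=
  LinearMap.trace ℝ V ((g.toDual hg).symm.toLinearMap ∘ₗ A)

end TensorAlg

/-! ## Semi-Riemannian manifolds and their curvature -/

section Manifold

variable (E : Type*) [NormedAddCommGroup E] [NormedSpace ℝ E]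
  (M : Type*) [TopologicalSpace M] [ChartedSpace E M] [IsManifold 𝓘(ℝ, E) ∞ M]

/-- A smooth semi-Riemannian metric on `M`: a smooth field of symmetric nondegenerate bilinear
forms on the tangent spaces, of arbitrary signature (the index is locally constant, hence constant
when `M` is connected). -/
structure SemiRiemannianMetric where
  /-- The scalar product on each tangent space. -/
  inner (x : M) : TangentSpace 𝓘(ℝ, E) x →L[ℝ] TangentSpace 𝓘(ℝ, E) x →L[ℝ] ℝ
  symm (x : M) (v w : TangentSpace 𝓘(ℝ, E) x) : inner x v w = inner x w v
  nondegenerate (x : M) (v : TangentSpace 𝓘(ℝ, E) x) (hv : ∀ w, inner x v w = 0) : v = 0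
  contMDiff : ContMDiff 𝓘(ℝ, E) (𝓘(ℝ, E).prod 𝓘(ℝ, E →L[ℝ] E →L[ℝ] ℝ)) ∞
    (fun x => Bundle.TotalSpace.mk' (E →L[ℝ] E →L[ℝ] ℝ) x (inner x))

end Manifold

namespace SemiRiemannianMetric

variable {E : Type*} [NormedAddCommGroup E] [NormedSpace ℝ E]
  {M : Type*} [TopologicalSpace M] [ChartedSpace E M] [IsManifold 𝓘(ℝ, E) ∞ M]
  (g : SemiRiemannianMetric E M)

/-- The expression of the metric in the preferred chart `φ` at `x`: the pullback
`y ↦ ((u, v) ↦ g_{φ⁻¹ y}(dφ⁻¹ u, dφ⁻¹ v))` of `g` under `φ⁻¹`, for `y` in the image of `φ`. -/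
def inChart (x : M) (y : E) : E →L[ℝ] E →L[ℝ] ℝ :=
  letI B : E →L[ℝ] E →L[ℝ] ℝ := g.inner ((extChartAt 𝓘(ℝ, E) x).symm y)
  letI A : E →L[ℝ] E := mfderiv 𝓘(ℝ, E) 𝓘(ℝ, E) (extChartAt 𝓘(ℝ, E) x).symm y
  B.bilinearComp A A

/-- The Christoffel symbols of the first kind in the preferred chart at `x`:
`(u, v, w) ↦ ½ (∂_u g(v, w) + ∂_v g(u, w) - ∂_w g(u, v))`, see `christoffelFst_apply`. -/
def christoffelFst (x : M) (y : E) : E →L[ℝ] E →L[ℝ] E →L[ℝ] ℝ :=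
  letI D : E →L[ℝ] E →L[ℝ] E →L[ℝ] ℝ := fderiv ℝ (g.inChart x) y
  (1 / 2 : ℝ) • (D + D.flip -
    (ContinuousLinearMap.flipₗᵢ ℝ E E ℝ).toContinuousLinearEquiv.toContinuousLinearMap ∘L D.flip)

theorem christoffelFst_apply (x : M) (y u v w : E) :
    g.christoffelFst x y u v w = 1 / 2 * (fderiv ℝ (g.inChart x) y u v w
      + fderiv ℝ (g.inChart x) y v u w - fderiv ℝ (g.inChart x) y w u v) := rfl

/-- The Levi-Civita connection in the preferred chart at `x`: `christoffel x y u v` is the vector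
`Γ(u, v)` with `g(Γ(u, v), w) = christoffelFst x y u v w` for all `w`, so that
`∇_u v = ∂_u v + Γ(u, v)`. -/
def christoffel (x : M) (y : E) : E →L[ℝ] E →L[ℝ] E :=
  ContinuousLinearMap.compL ℝ E (E →L[ℝ] ℝ) E (g.inChart x y).inverse ∘L g.christoffelFst x y

/-- The curvature operator `R(X, Y) = [∇_X, ∇_Y] - ∇_{[X, Y]}` in the preferred chart at `x`. -/
def curvatureInChart (x : M) (y X Y : E) : E →L[ℝ] E :=
  fderiv ℝ (g.christoffel x) y X Y - fderiv ℝ (g.christoffel x) y Y X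
    + g.christoffel x y X ∘L g.christoffel x y Y - g.christoffel x y Y ∘L g.christoffel x y X

/-- The metric at `x` as a bilinear form. -/
def form (x : M) : LinearMap.BilinForm ℝ (TangentSpace 𝓘(ℝ, E) x) :=
  (g.inner x).toLinearMap₁₂

theorem form_apply (x : M) (v w : TangentSpace 𝓘(ℝ, E) x) : g.form x v w = g.inner x v w := rfl

theorem form_nondegenerate (x : M) : (g.form x).Nondegenerate := by
  refine ⟨fun v hv => g.nondegenerate x v hv, fun v hv => g.nondegenerate x v fun w => ?_⟩
  rw [g.symm]; exact hv w

/-- The Riemann curvature tensor of type `(1,3)` at `x`, `curvature x X Y Z = R(X, Y) Z`. The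
preferred chart at `x` identifies `T_x M` with the model space `E` (this is how Mathlib defines
`TangentSpace`), and the tensor is computed in that chart. -/
def curvature (x : M) : TangentSpace 𝓘(ℝ, E) x →ₗ[ℝ] TangentSpace 𝓘(ℝ, E) x →ₗ[ℝ]
    TangentSpace 𝓘(ℝ, E) x →ₗ[ℝ] TangentSpace 𝓘(ℝ, E) x :=
  letI R : E →ₗ[ℝ] E →ₗ[ℝ] E →ₗ[ℝ] E :=
    LinearMap.mk₂ ℝ (fun X Y =>
        (g.curvatureInChart x (extChartAt 𝓘(ℝ, E) x x) X Y).toLinearMap)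
      (fun X X' Y => by ext Z; simp [curvatureInChart]; abel)
      (fun c X Y => by ext Z; simp [curvatureInChart, smul_sub, smul_add])
      (fun X Y Y' => by ext Z; simp [curvatureInChart]; abel)
      (fun c X Y => by ext Z; simp [curvatureInChart, smul_sub, smul_add])
  R

open TensorAlg

/-- The Riemann–Christoffel curvature tensor of type `(0,4)`, `R(X₁,X₂,X₃,X₄) = g(R(X₁,X₂)X₃,X₄)`. -/
def riemann (x : M) : (Fin 4 → TangentSpace 𝓘(ℝ, E) x) → ℝ := lower (g.form x) (g.curvature x)

/-- The Ricci tensor `S`. -/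
def ric (x : M) : LinearMap.BilinForm ℝ (TangentSpace 𝓘(ℝ, E) x) := ricci (g.curvature x)

variable [FiniteDimensional ℝ E]

instance (x : M) : FiniteDimensional ℝ (TangentSpace 𝓘(ℝ, E) x) :=
  inferInstanceAs (FiniteDimensional ℝ E)

/-- The scalar curvature `κ`. -/
def scal (x : M) : ℝ := traceForm (g.form x) (g.form_nondegenerate x) (g.ric x)

/-- The Weyl conformal curvature tensor
`C = R - 1/(n-2) g ∧ S + κ/(2(n-1)(n-2)) g ∧ g` of type `(0,4)`, where `n = dim M`. -/
def weyl (x : M) : (Fin 4 → TangentSpace 𝓘(ℝ, E) x) → ℝ :=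
  letI n : ℝ := Module.finrank ℝ E
  g.riemann x - (1 / (n - 2)) • kn (g.form x) (g.ric x)
    + (g.scal x / (2 * (n - 1) * (n - 2))) • kn (g.form x) (g.form x)

/-- The set `U_S` of the points at which `S ≠ (κ/n) g`. -/
def US : Set M := {x | g.ric x - (g.scal x / Module.finrank ℝ E) • g.form x ≠ 0}

end SemiRiemannianMetric

end

/-! Beyond the standard symmetries of the curvature tensor, the statement is linear algebra on one
tangent space. Since `R · g = 0 = Q(g, g)`, both `g` and `S` satisfy `R · A = L Q(g, A)` with `L =
L_S`, and by the Leibniz rule so do `g ∧ g`, `g ∧ S` and `S ∧ S` (`IsPseudoParallel.dot_kn₄`). Hence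
the claim for `R` is equivalent to the claim for `C`, and it holds as soon as `C` is a combination
of such products (`dot_eq_of_eq_kn₄`).

Subtracting the two curvature hypotheses gives `(L₂ - 1) Q(S, C) = L₁ Q(g, C) + α Q(S, g ∧ S) + γ
Q(S, g ∧ g)`. The identity `Q(A, B ∧ A) = -½ Q(B, A ∧ A)` (`Q₄_kn₄`) turns this into `Q(A, W) = 0`,
where `W` is a nonzero multiple of `C` plus Kulkarni–Nomizu products. If `L₂ = 1`, then `L₁ ≠ 0` and
`A = g`; otherwise `A = S - l g` with `l = L₁ / (L₂ - 1)`, which is nonzero on `U_S`.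

If `A` has rank at least two, `Q(A, W) = 0` forces `W = r A ∧ A` (`curvatureLike_eq_kn_self`), and
`C` is of the required form. If `A` has rank one, `W` is only a product `A ∧ H`. Tracelessness of
`C` then removes the `g ∧ g` term and shows that the vector `U` dual to `A(e, ·)` annihilates `C`.
Moreover `Q(A, C) = 0`, so `R · C = L₂ l Q(g, C)`; testing this on `U` gives `L₂ l = L` or `C = 0`
(`dot_eq_of_rank_one`). -/

namespace SemiRiemannianMetric

open scoped Topology

variable {E : Type*} [NormedAddCommGroup E] [NormedSpace ℝ E]
  {M : Type*} [TopologicalSpace M] [ChartedSpace E M] [IsManifold 𝓘(ℝ, E) ∞ M]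
  (g : SemiRiemannianMetric E M)

/-! ### Symmetries of the curvature tensor, computed in a chart -/

theorem inChart_apply (x : M) (y u v : E) :
    g.inChart x y u v = g.inner ((extChartAt 𝓘(ℝ, E) x).symm y)
      (mfderiv 𝓘(ℝ, E) 𝓘(ℝ, E) (extChartAt 𝓘(ℝ, E) x).symm y u)
      (mfderiv 𝓘(ℝ, E) 𝓘(ℝ, E) (extChartAt 𝓘(ℝ, E) x).symm y v) := rfl

theorem inChart_symm (x : M) (y u v : E) : g.inChart x y u v = g.inChart x y v u := by
  rw [inChart_apply, inChart_apply, g.symm]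

/-- The tangent trivialization at `x` is inverted by the derivative of the inverse chart. Smoothness
of the metric as a section thus becomes smoothness of its chart expression. -/
theorem inChart_eq_inCoordinates (x : M) {y : E} (hy : y ∈ (extChartAt 𝓘(ℝ, E) x).target) :
    g.inChart x y = ContinuousLinearMap.inCoordinates E (TangentSpace 𝓘(ℝ, E)) (E →L[ℝ] ℝ)
      (fun x : M => TangentSpace 𝓘(ℝ, E) x →L[ℝ] ℝ) x ((extChartAt 𝓘(ℝ, E) x).symm y) x
      ((extChartAt 𝓘(ℝ, E) x).symm y) (g.inner ((extChartAt 𝓘(ℝ, E) x).symm y)) := by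
  have hs : (extChartAt 𝓘(ℝ, E) x).symm y ∈ (chartAt E x).source := by
    have := (extChartAt 𝓘(ℝ, E) x).map_target hy
    rwa [extChartAt_source] at this
  have : IsManifold 𝓘(ℝ, E) 1 M := IsManifold.of_le (n := ∞) (by simp)
  have hb : (extChartAt 𝓘(ℝ, E) x).symm y ∈
      (trivializationAt E (TangentSpace 𝓘(ℝ, E)) x).baseSet := by simpa using hs
  have key := TangentBundle.symmL_trivializationAt (I := 𝓘(ℝ, E)) hs
  rw [(extChartAt 𝓘(ℝ, E) x).right_inv hy, modelWithCornersSelf_coe, Set.range_id,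
    mfderivWithin_univ] at key
  ext u v
  have hu := congrArg (fun L : E →L[ℝ] E => L u) key
  have hv := congrArg (fun L : E →L[ℝ] E => L v) key
  rw [inChart_apply]
  erw [inCoordinates_apply_eq₂ (E₃ := fun _ : M => ℝ) (F₃ := ℝ)
    (by simpa using hs) (by simpa using hs) (by simp)]
  erw [Bundle.Trivial.linearMapAt_trivialization, ← hu, ← hv, Bundle.Trivialization.symmL_apply _ hb,
    Bundle.Trivialization.symmL_apply _ hb]
  rfl

theorem contDiffAt_inChart (x : M) :
    ContDiffAt ℝ ∞ (g.inChart x) (extChartAt 𝓘(ℝ, E) x x) := by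
  have h := (contMDiffAt_hom_bundle _).1 (g.contMDiff x)
  have h2 := h.2
  have h3 : ContMDiffAt 𝓘(ℝ, E) 𝓘(ℝ, E) ∞ (extChartAt 𝓘(ℝ, E) x).symm
      (extChartAt 𝓘(ℝ, E) x x) := by
    have := contMDiffOn_extChartAt_symm (I := 𝓘(ℝ, E)) (n := ∞) x
    exact this.contMDiffAt (extChartAt_target_mem_nhds x)
  have h4 := ContMDiffAt.comp_of_eq h2 h3 (extChartAt_to_inv x)
  refine (contMDiffAt_iff_contDiffAt.1 h4).congr_of_eventuallyEq ?_
  filter_upwards [extChartAt_target_mem_nhds (I := 𝓘(ℝ, E)) x] with y hy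
  exact g.inChart_eq_inCoordinates x hy

theorem inChart_self (x : M) : g.inChart x (extChartAt 𝓘(ℝ, E) x x) = g.inner x := by
  have : IsManifold 𝓘(ℝ, E) 1 M := IsManifold.of_le (n := ∞) (by simp)
  have key := mfderivWithin_range_extChartAt_symm (I := 𝓘(ℝ, E)) (x := x)
  rw [modelWithCornersSelf_coe, Set.range_id, mfderivWithin_univ] at key
  -- The point `φ⁻¹ (φ x)` equals `x` only propositionally, so the metric is transported with values
  -- read in `E`.
  have hz : ∀ z : M, z = x → ∀ u v : E, (g.inner z : E →L[ℝ] E →L[ℝ] ℝ) u v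
      = (g.inner x : E →L[ℝ] E →L[ℝ] ℝ) u v := by rintro z rfl u v; rfl
  ext u v
  have hu := congrArg (fun L : E →L[ℝ] E => L u) key
  have hv := congrArg (fun L : E →L[ℝ] E => L v) key
  rw [inChart_apply]
  erw [hu, hv]
  exact hz _ (extChartAt_to_inv x) u v

theorem contDiffAt_christoffelFst (x : M) :
    ContDiffAt ℝ ∞ (g.christoffelFst x) (extChartAt 𝓘(ℝ, E) x x) := by
  have hD : ContDiffAt ℝ ∞ (fderiv ℝ (g.inChart x)) (extChartAt 𝓘(ℝ, E) x x) :=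
    (g.contDiffAt_inChart x).fderiv_right (by simp)
  have hF : ContDiffAt ℝ ∞ (fun y => (fderiv ℝ (g.inChart x) y).flip)
      (extChartAt 𝓘(ℝ, E) x x) :=
    (ContinuousLinearMap.flipₗᵢ ℝ E E (E →L[ℝ] ℝ)).toContinuousLinearEquiv.contDiff.contDiffAt.comp
      _ hD
  exact ContDiffAt.const_smul _ ((hD.add hF).sub (contDiffAt_const.clm_comp hF))

theorem fderiv_inChart_symm (x : M) (y X u v : E) :
    fderiv ℝ (g.inChart x) y X u v = fderiv ℝ (g.inChart x) y X v u := by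
  have h : (fun y => (g.inChart x y).flip) = g.inChart x := by
    ext y u v; exact g.inChart_symm x y v u
  have h2 := (ContinuousLinearMap.flipₗᵢ ℝ E E ℝ).toContinuousLinearEquiv.comp_fderiv
    (f := g.inChart x) (x := y)
  have h3 : (⇑(ContinuousLinearMap.flipₗᵢ ℝ E E ℝ).toContinuousLinearEquiv ∘ g.inChart x) =
    g.inChart x := h
  rw [h3] at h2
  conv_lhs => rw [h2]
  rfl

theorem christoffelFst_symm (x : M) (y u v w : E) :
    g.christoffelFst x y u v w = g.christoffelFst x y v u w := by
  rw [christoffelFst_apply, christoffelFst_apply, fderiv_inChart_symm g x y w u v]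
  ring

theorem christoffelFst_add (x : M) (y u v w : E) :
    g.christoffelFst x y u v w + g.christoffelFst x y u w v =
      fderiv ℝ (g.inChart x) y u v w := by
  rw [christoffelFst_apply, christoffelFst_apply, fderiv_inChart_symm g x y w u v,
    fderiv_inChart_symm g x y v u w, fderiv_inChart_symm g x y u w v]
  ring

theorem christoffel_apply (x : M) (y u v : E) :
    g.christoffel x y u v = (g.inChart x y).inverse (g.christoffelFst x y u v) := rfl

theorem christoffel_symm (x : M) (y u v : E) :
    g.christoffel x y u v = g.christoffel x y v u := by
  rw [christoffel_apply, christoffel_apply]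
  congr 1
  ext w
  exact g.christoffelFst_symm x y u v w

/-- Derivative of the metric compatibility `christoffelFst_add`. -/
theorem fderiv_christoffelFst_add (x : M) (X u v w : E) :
    fderiv ℝ (g.christoffelFst x) (extChartAt 𝓘(ℝ, E) x x) X u v w +
        fderiv ℝ (g.christoffelFst x) (extChartAt 𝓘(ℝ, E) x x) X u w v =
      fderiv ℝ (fderiv ℝ (g.inChart x)) (extChartAt 𝓘(ℝ, E) x x) X u v w := by
  set y₀ := extChartAt 𝓘(ℝ, E) x x
  have hF : HasFDerivAt (g.christoffelFst x) (fderiv ℝ (g.christoffelFst x) y₀) y₀ :=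
    ((g.contDiffAt_christoffelFst x).differentiableAt (by simp)).hasFDerivAt
  have hD : HasFDerivAt (fderiv ℝ (g.inChart x)) (fderiv ℝ (fderiv ℝ (g.inChart x)) y₀) y₀ :=
    (((g.contDiffAt_inChart x).fderiv_right (m := ∞) (by simp)).differentiableAt
      (by simp)).hasFDerivAt
  have h1 := ((hF.clm_apply (hasFDerivAt_const u y₀)).clm_apply
    (hasFDerivAt_const v y₀)).clm_apply (hasFDerivAt_const w y₀)
  have h2 := ((hF.clm_apply (hasFDerivAt_const u y₀)).clm_apply
    (hasFDerivAt_const w y₀)).clm_apply (hasFDerivAt_const v y₀)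
  have h3 := ((hD.clm_apply (hasFDerivAt_const u y₀)).clm_apply
    (hasFDerivAt_const v y₀)).clm_apply (hasFDerivAt_const w y₀)
  rw [show (fun y => fderiv ℝ (g.inChart x) y u v w) =
    (fun y => g.christoffelFst x y u v w) + fun y => g.christoffelFst x y u w v from
    funext fun y => (g.christoffelFst_add x y u v w).symm] at h3
  have := congrArg (fun L : E →L[ℝ] ℝ => L X) ((h1.add h2).unique h3)
  simpa using this

theorem fderiv_fderiv_inChart_symm (x : M) (X Y : E) :
    fderiv ℝ (fderiv ℝ (g.inChart x)) (extChartAt 𝓘(ℝ, E) x x) X Y =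
      fderiv ℝ (fderiv ℝ (g.inChart x)) (extChartAt 𝓘(ℝ, E) x x) Y X :=
  ((g.contDiffAt_inChart x).isSymmSndFDerivAt (by
    rw [minSmoothness_of_isRCLikeNormedField]; exact ENat.LEInfty.out)) X Y

theorem curvatureInChart_skew (x : M) (y X Y Z : E) :
    g.curvatureInChart x y X Y Z = - g.curvatureInChart x y Y X Z := by
  simp only [curvatureInChart, add_apply, sub_apply]
  abel

theorem curvature_skew (x : M) (X Y Z : TangentSpace 𝓘(ℝ, E) x) :
    g.curvature x X Y Z = - g.curvature x Y X Z :=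
  g.curvatureInChart_skew x _ X Y Z

variable [FiniteDimensional ℝ E]

theorem isInvertible_inChart_self (x : M) :
    (g.inChart x (extChartAt 𝓘(ℝ, E) x x)).IsInvertible := by
  have hinj : Function.Injective (g.inner x : E →L[ℝ] E →L[ℝ] ℝ) := by
    rw [injective_iff_map_eq_zero]
    intro v hv
    refine g.nondegenerate x v fun w => ?_
    exact congrArg (fun L : E →L[ℝ] ℝ => L w) hv
  have hdim : Module.finrank ℝ E = Module.finrank ℝ (E →L[ℝ] ℝ) := by
    rw [← (LinearMap.toContinuousLinearMap (𝕜 := ℝ) (E := E) (F' := ℝ)).finrank_eq]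
    exact Subspace.dual_finrank_eq.symm
  have hL : ∀ L : E →L[ℝ] E →L[ℝ] ℝ, Function.Injective L → L.IsInvertible := by
    intro L hL
    refine ⟨(LinearEquiv.ofInjectiveOfFinrankEq L.toLinearMap hL hdim).toContinuousLinearEquiv, ?_⟩
    ext v w
    rfl
  rw [inChart_self]
  exact hL _ hinj

theorem eventually_isInvertible_inChart (x : M) :
    ∀ᶠ y in 𝓝 (extChartAt 𝓘(ℝ, E) x x), (g.inChart x y).IsInvertible := by
  have : CompleteSpace E := FiniteDimensional.complete ℝ E
  obtain ⟨e, he⟩ := g.isInvertible_inChart_self x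
  have h := (g.contDiffAt_inChart x).continuousAt
  have h2 := ContinuousLinearEquiv.nhds e
  rw [he] at h2
  filter_upwards [h h2] with y hy
  exact hy

theorem contDiffAt_christoffel (x : M) :
    ContDiffAt ℝ ∞ (g.christoffel x) (extChartAt 𝓘(ℝ, E) x x) := by
  have : CompleteSpace E := FiniteDimensional.complete ℝ E
  have hI : ContDiffAt ℝ ∞ (fun y => (g.inChart x y).inverse) (extChartAt 𝓘(ℝ, E) x x) :=
    (g.isInvertible_inChart_self x).contDiffAt_map_inverse.comp _ (g.contDiffAt_inChart x)
  have hC := (ContinuousLinearMap.compL ℝ E (E →L[ℝ] ℝ) E).contDiff.contDiffAt.comp _ hI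
  exact hC.clm_comp (g.contDiffAt_christoffelFst x)

/-- `inverse` takes the value zero at non-invertible maps, so the defining relation of `Γ` is
available only where the metric is invertible; a neighbourhood suffices for differentiating it. -/
theorem eventually_inChart_christoffel (x : M) :
    ∀ᶠ y in 𝓝 (extChartAt 𝓘(ℝ, E) x x), ∀ u v w,
      g.inChart x y (g.christoffel x y u v) w = g.christoffelFst x y u v w := by
  filter_upwards [g.eventually_isInvertible_inChart x] with y hy u v w
  rw [christoffel_apply, hy.self_apply_inverse]

theorem inChart_fderiv_christoffel (x : M) (X u v w : E) :
    g.inChart x (extChartAt 𝓘(ℝ, E) x x)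
        (fderiv ℝ (g.christoffel x) (extChartAt 𝓘(ℝ, E) x x) X u v) w =
      fderiv ℝ (g.christoffelFst x) (extChartAt 𝓘(ℝ, E) x x) X u v w -
      fderiv ℝ (g.inChart x) (extChartAt 𝓘(ℝ, E) x x) X
        (g.christoffel x (extChartAt 𝓘(ℝ, E) x x) u v) w := by
  set y₀ := extChartAt 𝓘(ℝ, E) x x
  have hG : HasFDerivAt (g.inChart x) (fderiv ℝ (g.inChart x) y₀) y₀ :=
    ((g.contDiffAt_inChart x).differentiableAt (by simp)).hasFDerivAt
  have hC : HasFDerivAt (g.christoffel x) (fderiv ℝ (g.christoffel x) y₀) y₀ :=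
    ((g.contDiffAt_christoffel x).differentiableAt (by simp)).hasFDerivAt
  have hF : HasFDerivAt (g.christoffelFst x) (fderiv ℝ (g.christoffelFst x) y₀) y₀ :=
    ((g.contDiffAt_christoffelFst x).differentiableAt (by simp)).hasFDerivAt
  have hC' := (hC.clm_apply (hasFDerivAt_const u y₀)).clm_apply (hasFDerivAt_const v y₀)
  have hL := (hG.clm_apply hC').clm_apply (hasFDerivAt_const w y₀)
  have hR := ((hF.clm_apply (hasFDerivAt_const u y₀)).clm_apply
    (hasFDerivAt_const v y₀)).clm_apply (hasFDerivAt_const w y₀)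
  have hL' := hL.congr_of_eventuallyEq (f₁ := fun y => g.christoffelFst x y u v w) (by
    filter_upwards [g.eventually_inChart_christoffel x] with y hy
    exact (hy u v w).symm)
  have := congrArg (fun L : E →L[ℝ] ℝ => L X) (hL'.unique hR)
  simp at this
  linarith

theorem fderiv_christoffel_symm (x : M) (X u v : E) :
    fderiv ℝ (g.christoffel x) (extChartAt 𝓘(ℝ, E) x x) X u v =
      fderiv ℝ (g.christoffel x) (extChartAt 𝓘(ℝ, E) x x) X v u := by
  set y₀ := extChartAt 𝓘(ℝ, E) x x
  have hC : HasFDerivAt (g.christoffel x) (fderiv ℝ (g.christoffel x) y₀) y₀ :=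
    ((g.contDiffAt_christoffel x).differentiableAt (by simp)).hasFDerivAt
  have h1 := (hC.clm_apply (hasFDerivAt_const u y₀)).clm_apply (hasFDerivAt_const v y₀)
  have h2 := (hC.clm_apply (hasFDerivAt_const v y₀)).clm_apply (hasFDerivAt_const u y₀)
  rw [show (fun y => g.christoffel x y v u) = fun y => g.christoffel x y u v from
    funext fun y => g.christoffel_symm x y v u] at h2
  have := congrArg (fun L : E →L[ℝ] E => L X) (h1.unique h2)
  simpa using this

/-- Torsion-freeness: `Γ` and its derivative are symmetric in the last two arguments, so the cyclic
sum cancels in pairs. -/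
theorem curvatureInChart_bianchi (x : M) (X Y Z : E) :
    g.curvatureInChart x (extChartAt 𝓘(ℝ, E) x x) X Y Z +
      g.curvatureInChart x (extChartAt 𝓘(ℝ, E) x x) Y Z X +
      g.curvatureInChart x (extChartAt 𝓘(ℝ, E) x x) Z X Y = 0 := by
  simp only [curvatureInChart, add_apply, sub_apply,
    ContinuousLinearMap.comp_apply]
  rw [g.fderiv_christoffel_symm x X Z Y, g.fderiv_christoffel_symm x Y X Z,
    g.fderiv_christoffel_symm x Z Y X, g.christoffel_symm x _ Z Y, g.christoffel_symm x _ Z X,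
    g.christoffel_symm x _ Y X]
  abel

theorem curvature_bianchi (x : M) (X Y Z : TangentSpace 𝓘(ℝ, E) x) :
    g.curvature x X Y Z + g.curvature x Y Z X + g.curvature x Z X Y = 0 :=
  g.curvatureInChart_bianchi x X Y Z

/-- Lowering an index of `∂Γ` costs a term `∂g(Γ, ·)`. By compatibility this splits in two: one half
cancels the `ΓΓ` term, the other gives the products `g(Γ, Γ)`. -/
theorem inChart_curvatureInChart (x : M) (X Y Z W : E) :
    g.inChart x (extChartAt 𝓘(ℝ, E) x x)
        (g.curvatureInChart x (extChartAt 𝓘(ℝ, E) x x) X Y Z) W =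
      fderiv ℝ (g.christoffelFst x) (extChartAt 𝓘(ℝ, E) x x) X Y Z W
      - fderiv ℝ (g.christoffelFst x) (extChartAt 𝓘(ℝ, E) x x) Y X Z W
      - g.inChart x (extChartAt 𝓘(ℝ, E) x x) (g.christoffel x (extChartAt 𝓘(ℝ, E) x x) X W)
          (g.christoffel x (extChartAt 𝓘(ℝ, E) x x) Y Z)
      + g.inChart x (extChartAt 𝓘(ℝ, E) x x) (g.christoffel x (extChartAt 𝓘(ℝ, E) x x) Y W)
          (g.christoffel x (extChartAt 𝓘(ℝ, E) x x) X Z) := by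
  have hG := (g.eventually_inChart_christoffel x).self_of_nhds
  simp only [curvatureInChart, add_apply, sub_apply,
    ContinuousLinearMap.comp_apply, map_add, map_sub, inChart_fderiv_christoffel, hG,
    ← christoffelFst_add]
  ring

/-- After symmetrization in `Z, W` the products `g(Γ, Γ)` cancel, and what remains is the commutator
of second derivatives of the metric. -/
theorem inner_curvature_skew (x : M) (X Y Z W : TangentSpace 𝓘(ℝ, E) x) :
    g.inner x (g.curvature x X Y Z) W = - g.inner x (g.curvature x X Y W) Z := by
  have h1 := g.inChart_curvatureInChart x X Y Z W
  have h2 := g.inChart_curvatureInChart x X Y W Z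
  have key : g.inChart x (extChartAt 𝓘(ℝ, E) x x)
        (g.curvatureInChart x (extChartAt 𝓘(ℝ, E) x x) X Y Z) W =
      - g.inChart x (extChartAt 𝓘(ℝ, E) x x)
        (g.curvatureInChart x (extChartAt 𝓘(ℝ, E) x x) X Y W) Z := by
    have h3 := g.fderiv_christoffelFst_add x X Y Z W
    have h4 := g.fderiv_christoffelFst_add x Y X Z W
    rw [g.fderiv_fderiv_inChart_symm x X Y] at h3
    rw [h1, h2, g.inChart_symm x _ (g.christoffel x _ X W), g.inChart_symm x _
      (g.christoffel x _ Y W)]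
    linarith
  rw [inChart_self] at key
  exact key

end SemiRiemannianMetric

/-! ### Symmetric forms and algebraic curvature tensors -/

namespace TensorAlg

variable {V : Type*} [AddCommGroup V] [Module ℝ V]

/-- Symmetric bilinear forms, as functions of two vectors. -/
structure IsSymmForm (A : V → V → ℝ) : Prop where
  symm : ∀ x y, A x y = A y x
  add_left : ∀ x x' y, A (x + x') y = A x y + A x' y
  smul_left : ∀ (c : ℝ) x y, A (c • x) y = c * A x y

namespace IsSymmForm

variable {A B : V → V → ℝ}

theorem add_right (hA : IsSymmForm A) (x y y' : V) : A x (y + y') = A x y + A x y' := by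
  rw [hA.symm, hA.add_left, hA.symm y, hA.symm y']

theorem smul_right (hA : IsSymmForm A) (c : ℝ) (x y : V) : A x (c • y) = c * A x y := by
  rw [hA.symm, hA.smul_left, hA.symm y]

theorem sub_left (hA : IsSymmForm A) (x x' y : V) : A (x - x') y = A x y - A x' y := by
  rw [sub_eq_add_neg, ← neg_one_smul ℝ x', hA.add_left, hA.smul_left]; ring

theorem sub_right (hA : IsSymmForm A) (x y y' : V) : A x (y - y') = A x y - A x y' := by
  rw [hA.symm, hA.sub_left, hA.symm y, hA.symm y']

theorem linearComb (hA : IsSymmForm A) (hB : IsSymmForm B) (r s : ℝ) :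
    IsSymmForm fun x y => r * A x y + s * B x y where
  symm x y := by rw [hA.symm, hB.symm]
  add_left x x' y := by rw [hA.add_left, hB.add_left]; ring
  smul_left c x y := by rw [hA.smul_left, hB.smul_left]; ring

theorem exists_self_ne_zero (hA : IsSymmForm A) (h : ∃ x y, A x y ≠ 0) : ∃ e, A e e ≠ 0 := by
  by_contra! h0
  obtain ⟨x, y, hxy⟩ := h
  have := h0 (x + y)
  rw [hA.add_left, hA.add_right, hA.add_right, h0, h0, hA.symm y x] at this
  exact hxy (by linarith)

/-- The linear functional `A(·, y)`. -/
def toLin (hA : IsSymmForm A) (y : V) : V →ₗ[ℝ] ℝ where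
  toFun x := A x y
  map_add' x x' := hA.add_left x x' y
  map_smul' c x := hA.smul_left c x y

theorem exists_eq_smul_add (hA : IsSymmForm A) {e : V} (he : A e e ≠ 0) (x : V) :
    ∃ (s : ℝ) (x' : V), A e x' = 0 ∧ x = s • e + x' :=
  ⟨A e x / A e e, x - (A e x / A e e) • e, by
    rw [hA.sub_right, hA.smul_right, div_mul_cancel₀ _ he, sub_self], by abel⟩

end IsSymmForm

theorem LinearMap.isSymmForm {A : V →ₗ[ℝ] V →ₗ[ℝ] ℝ} (h : ∀ x y, A x y = A y x) :
    IsSymmForm fun x y => A x y where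
  symm := h
  add_left := by simp
  smul_left := by simp

/-- Algebraic curvature tensors, as functions of four vectors. -/
structure IsCurvatureLike (T : V → V → V → V → ℝ) : Prop where
  add₁ : ∀ x x' y z w, T (x + x') y z w = T x y z w + T x' y z w
  smul₁ : ∀ (c : ℝ) x y z w, T (c • x) y z w = c * T x y z w
  skew₁₂ : ∀ x y z w, T x y z w = -T y x z w
  skew₃₄ : ∀ x y z w, T x y z w = -T x y w z
  bianchi : ∀ x y z w, T x y z w + T y z x w + T z x y w = 0

namespace IsCurvatureLike

variable {T T' : V → V → V → V → ℝ}

theorem pair (h : IsCurvatureLike T) (x y z w : V) : T x y z w = T z w x y := by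
  have h1 := h.bianchi x y z w
  have h2 := h.bianchi y z w x
  have h3 := h.bianchi z w x y
  have h4 := h.bianchi w x y z
  linarith [h.skew₁₂ x y z w, h.skew₃₄ x y z w, h.skew₁₂ y z x w, h.skew₃₄ y z x w,
    h.skew₁₂ z x y w, h.skew₃₄ z x y w, h.skew₁₂ z w y x, h.skew₃₄ z w y x,
    h.skew₁₂ w y z x, h.skew₃₄ w y z x, h.skew₁₂ w x z y, h.skew₃₄ w x z y,
    h.skew₁₂ x z w y, h.skew₃₄ x z w y, h.skew₁₂ x y w z, h.skew₃₄ x y w z,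
    h.skew₁₂ y w x z, h.skew₃₄ y w x z, h.skew₁₂ y z w x, h.skew₁₂ z w x y, h.skew₃₄ z w x y,
    h.skew₁₂ x w z y, h.skew₁₂ w x y z, h.skew₃₄ y z w x, h.skew₃₄ z x w y, h.skew₃₄ y w z x]

theorem add₂ (h : IsCurvatureLike T) (x y y' z w : V) :
    T x (y + y') z w = T x y z w + T x y' z w := by
  rw [h.skew₁₂, h.add₁, h.skew₁₂ y, h.skew₁₂ y']; ring

theorem smul₂ (h : IsCurvatureLike T) (c : ℝ) (x y z w : V) :
    T x (c • y) z w = c * T x y z w := by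
  rw [h.skew₁₂, h.smul₁, h.skew₁₂ y]; ring

theorem add₃ (h : IsCurvatureLike T) (x y z z' w : V) :
    T x y (z + z') w = T x y z w + T x y z' w := by
  rw [h.pair, h.add₁, h.pair z, h.pair z']

theorem smul₃ (h : IsCurvatureLike T) (c : ℝ) (x y z w : V) :
    T x y (c • z) w = c * T x y z w := by
  rw [h.pair, h.smul₁, h.pair z]

theorem add₄ (h : IsCurvatureLike T) (x y z w w' : V) :
    T x y z (w + w') = T x y z w + T x y z w' := by
  rw [h.pair, h.add₂, h.pair z, h.pair z]

theorem smul₄ (h : IsCurvatureLike T) (c : ℝ) (x y z w : V) :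
    T x y z (c • w) = c * T x y z w := by
  rw [h.pair, h.smul₂, h.pair z]

theorem self₁₂ (h : IsCurvatureLike T) (x z w : V) : T x x z w = 0 := by
  linarith [h.skew₁₂ x x z w]

theorem self₃₄ (h : IsCurvatureLike T) (x y z : V) : T x y z z = 0 := by
  linarith [h.skew₃₄ x y z z]

theorem linearComb (h : IsCurvatureLike T) (h' : IsCurvatureLike T') (r s : ℝ) :
    IsCurvatureLike fun x y z w => r * T x y z w + s * T' x y z w where
  add₁ x x' y z w := by rw [h.add₁, h'.add₁]; ring
  smul₁ c x y z w := by rw [h.smul₁, h'.smul₁]; ring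
  skew₁₂ x y z w := by rw [h.skew₁₂, h'.skew₁₂]; ring
  skew₃₄ x y z w := by rw [h.skew₃₄, h'.skew₃₄]; ring
  bianchi x y z w := by linear_combination r * h.bianchi x y z w + s * h'.bianchi x y z w

/-- The symmetric form `T(e, ·, ·, e)`. -/
theorem isSymmForm (h : IsCurvatureLike T) (e : V) : IsSymmForm fun y z => T e y z e where
  symm y z := by rw [h.pair, h.skew₁₂, h.skew₃₄, neg_neg]
  add_left y y' z := h.add₂ e y y' z e
  smul_left c y z := h.smul₂ c e y z e

end IsCurvatureLike

/-- The Kulkarni–Nomizu product as a function of four vectors. -/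
def kn₄ (A B : V → V → ℝ) (x y z w : V) : ℝ :=
  A x w * B y z + A y z * B x w - A x z * B y w - A y w * B x z

theorem IsSymmForm.kn₄ {A B : V → V → ℝ} (hA : IsSymmForm A) (hB : IsSymmForm B) :
    IsCurvatureLike (kn₄ A B) where
  add₁ x x' y z w := by simp only [TensorAlg.kn₄, hA.add_left, hB.add_left]; ring
  smul₁ c x y z w := by simp only [TensorAlg.kn₄, hA.smul_left, hB.smul_left]; ring
  skew₁₂ x y z w := by simp only [TensorAlg.kn₄]; ring
  skew₃₄ x y z w := by simp only [TensorAlg.kn₄]; ring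
  bianchi x y z w := by
    simp only [TensorAlg.kn₄]
    rw [hA.symm z x, hB.symm z x, hA.symm y x, hB.symm y x, hA.symm z y, hB.symm z y]
    ring

/-- The tensor `Q(A, T)` of a `(0,4)`-tensor `T`. -/
def Q₄ (A : V → V → ℝ) (T : V → V → V → V → ℝ) (x y z w X Y : V) : ℝ :=
  -(A Y x * T X y z w - A X x * T Y y z w + (A Y y * T x X z w - A X y * T x Y z w)
    + (A Y z * T x y X w - A X z * T x y Y w) + (A Y w * T x y z X - A X w * T x y z Y))

/-- The tensor `D · T` of a `(0,4)`-tensor `T`. -/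
def dot₄ (D : V → V → V → V) (T : V → V → V → V → ℝ) (x y z w X Y : V) : ℝ :=
  -(T (D X Y x) y z w + T x (D X Y y) z w + T x y (D X Y z) w + T x y z (D X Y w))

/-- This exchange rule lets `g` and `S` trade places, so that all terms can be collected under a
single `Q(A, ·)`. -/
theorem Q₄_kn₄ {A B : V → V → ℝ} (hA : IsSymmForm A) (hB : IsSymmForm B) (x y z w X Y : V) :
    Q₄ A (kn₄ B A) x y z w X Y = -(1 / 2) * Q₄ B (kn₄ A A) x y z w X Y := by
  simp only [Q₄, kn₄]
  rw [hA.symm X x, hA.symm X y, hA.symm X z, hA.symm X w, hA.symm Y x, hA.symm Y y, hA.symm Y z,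
    hA.symm Y w, hB.symm X x, hB.symm X y, hB.symm X z, hB.symm X w, hB.symm Y x, hB.symm Y y,
    hB.symm Y z, hB.symm Y w]
  ring

theorem kn₄_comm {V : Type*} (A B : V → V → ℝ) : kn₄ A B = kn₄ B A := by
  ext x y z w; simp only [kn₄]; ring

theorem Q₄_kn₄_self {A : V → V → ℝ} (hA : IsSymmForm A) (x y z w X Y : V) :
    Q₄ A (kn₄ A A) x y z w X Y = 0 := by
  linarith [Q₄_kn₄ hA hA x y z w X Y]

/-! ### Curvature-like tensors `W` with `Q(A, W) = 0` -/

section KernelOfQ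

variable {A : V → V → ℝ} {W : V → V → V → V → ℝ} {e : V}

/-- Each argument splits along `e` and its `A`-orthogonal complement; by the symmetries of `W` only
three types of components remain. -/
theorem IsCurvatureLike.eq_zero_of_orthogonal (hA : IsSymmForm A) (he : A e e ≠ 0)
    (hW : IsCurvatureLike W)
    (h₁ : ∀ x y z, A e x = 0 → A e y = 0 → A e z = 0 → W e x y z = 0)
    (h₂ : ∀ x y, A e x = 0 → A e y = 0 → W e x y e = 0)
    (h₃ : ∀ x y z w, A e x = 0 → A e y = 0 → A e z = 0 → A e w = 0 → W x y z w = 0)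
    (x y z w : V) : W x y z w = 0 := by
  obtain ⟨s₁, x, hx, rfl⟩ := hA.exists_eq_smul_add he x
  obtain ⟨s₂, y, hy, rfl⟩ := hA.exists_eq_smul_add he y
  obtain ⟨s₃, z, hz, rfl⟩ := hA.exists_eq_smul_add he z
  obtain ⟨s₄, w, hw, rfl⟩ := hA.exists_eq_smul_add he w
  simp only [hW.add₁, hW.add₂, hW.add₃, hW.add₄, hW.smul₁, hW.smul₂, hW.smul₃, hW.smul₄,
    hW.self₁₂, hW.self₃₄]
  rw [hW.skew₃₄ e y e w, hW.skew₁₂ x e z e, hW.skew₁₂ x e e w, hW.skew₃₄ e x e w,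
    hW.skew₁₂ x e z w, hW.pair x y e w, hW.skew₃₄ x y z e, hW.pair x y e z,
    h₁ y z w hy hz hw, h₁ x z w hx hz hw, h₁ w x y hw hx hy, h₁ z x y hz hx hy, h₂ y z hy hz,
    h₂ y w hy hw, h₂ x z hx hz, h₂ x w hx hw, h₃ x y z w hx hy hz hw]
  ring

/-- Testing on `(e, v, t, e; u, e)` makes `W(e, ·, ·, ·)` cyclically invariant on the complement of
`e`, while the Bianchi identity says that its cyclic sum is zero. -/
theorem curvatureLike_apply_orthogonal_eq_zero (hA : IsSymmForm A) (he : A e e ≠ 0)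
    (hW : IsCurvatureLike W) (hQ : ∀ x y z w X Y, Q₄ A W x y z w X Y = 0) (x y z : V)
    (hx : A e x = 0) (hy : A e y = 0) (hz : A e z = 0) : W e x y z = 0 := by
  have key : ∀ u v t, A e u = 0 → A e v = 0 → A e t = 0 → W e v t u = W e t u v := by
    intro u v t hu hv ht
    have h := hQ e v t e u e
    simp only [Q₄, hA.symm _ e, hu, hv, ht, hW.self₁₂, hW.self₃₄] at h
    have h2 : A e e * (W u v t e + W e v t u) = 0 := by linarith
    have h3 := (mul_eq_zero.1 h2).resolve_left he
    have h4 : W u v t e = - W e t u v := by rw [hW.pair, hW.skew₁₂]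
    linarith
  have h1 := key z x y hz hx hy
  have h2 := key x y z hx hy hz
  have h3 := hW.bianchi x y z e
  rw [hW.pair x y z e, hW.pair y z x e, hW.pair z x y e, hW.skew₁₂ z e, hW.skew₁₂ x e,
    hW.skew₁₂ y e] at h3
  linarith

theorem curvatureLike_mul_eq_of_orthogonal (hA : IsSymmForm A)
    (hW : IsCurvatureLike W) (hQ : ∀ x y z w X Y, Q₄ A W x y z w X Y = 0) (x y z w : V)
    (hx : A e x = 0) (hy : A e y = 0) (hz : A e z = 0) (hw : A e w = 0) :
    A e e * W x y z w = A x w * W e y z e - A x z * W e y w e := by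
  have h := hQ e y z w x e
  simp only [Q₄, hA.symm _ e, hx, hy, hz, hw, hW.self₁₂] at h
  rw [hW.skew₃₄ e y e w] at h
  linarith

theorem curvatureLike_eq_kn_self (hA : IsSymmForm A) (he : A e e ≠ 0)
    (hW : IsCurvatureLike W) (hQ : ∀ x y z w X Y, Q₄ A W x y z w X Y = 0) {f : V}
    (hf : A e f = 0) (hff : A f f ≠ 0) :
    ∃ r : ℝ, ∀ x y z w, W x y z w = r * kn₄ A A x y z w := by
  have hh : ∀ x y, A e x = 0 → A e y = 0 → W e x y e = W e f f e / A f f * A x y := by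
    intro x y hx hy
    have hs := hW.isSymmForm e
    -- Skewness of `W x f y f` in its first two arguments, expressed through `W(e, ·, ·, e)`.
    -- Symmetrization in `x, y` removes the mixed terms.
    have key : ∀ x y, A e x = 0 → A e y = 0 →
        A x f * W e f y e - A x y * W e f f e + (A f f * W e x y e - A f y * W e x f e) = 0 := by
      intro x y hx hy
      have h1 := curvatureLike_mul_eq_of_orthogonal hA hW hQ x f y f hx hf hy hf
      have h2 := curvatureLike_mul_eq_of_orthogonal hA hW hQ f x y f hf hx hy hf
      have h3 := hW.skew₁₂ x f y f
      linear_combination -h1 - h2 + A e e * h3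
    have h1 := key x y hx hy
    have h2 := key y x hy hx
    rw [hs.symm f y, hA.symm f y] at h1
    rw [hs.symm f x, hA.symm f x, hs.symm y x, hA.symm y x] at h2
    field_simp
    linarith
  -- The factor 2 comes from `kn₄ A A e x y e = 2 * A e e * A x y` for `x, y` orthogonal to `e`.
  refine ⟨W e f f e / A f f / (2 * A e e), fun x y z w => ?_⟩
  have hW' := hW.linearComb (hA.kn₄ hA) 1 (-(W e f f e / A f f / (2 * A e e)))
  have := hW'.eq_zero_of_orthogonal hA he ?_ ?_ ?_ x y z w
  · linarith
  · intro x y z hx hy hz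
    rw [curvatureLike_apply_orthogonal_eq_zero hA he hW hQ x y z hx hy hz]
    simp [kn₄, hy, hz]
  · intro x y hx hy
    rw [hh x y hx hy]
    simp only [kn₄, hx, hy, hA.symm _ e]
    field_simp
    ring
  · intro x y z w hx hy hz hw
    have h := curvatureLike_mul_eq_of_orthogonal hA hW hQ x y z w hx hy hz hw
    rw [hh y z hy hz, hh y w hy hw] at h
    simp only [kn₄]
    field_simp
    field_simp at h
    linear_combination 2 * h

/-- By polarization `A` vanishes on the complement of `e`, so it has rank one: it is `w ⊗ w / A(e,
e)` with `w = A(e, ·)`. -/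
theorem IsSymmForm.mul_self_eq_of_orthogonal (hA : IsSymmForm A) (he : A e e ≠ 0)
    (h0 : ∀ f, A e f = 0 → A f f = 0) (x y : V) : A e e * A x y = A e x * A e y := by
  obtain ⟨s, x, hx, rfl⟩ := hA.exists_eq_smul_add he x
  obtain ⟨t, y, hy, rfl⟩ := hA.exists_eq_smul_add he y
  have h1 := h0 (x + y) (by rw [hA.add_right, hx, hy, add_zero])
  simp only [hA.add_left, hA.add_right, hA.smul_left, hA.smul_right, hA.symm _ e, hx, hy,
    h0 x hx, h0 y hy, hA.symm y x] at h1 ⊢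
  linear_combination (A e e / 2) * h1

/-- Here the complement of `e` is the radical of `A`. The form `W(e, ·, ·, e)` is therefore
unconstrained on it, unlike in higher rank. -/
theorem curvatureLike_eq_kn_of_rank_one (hA : IsSymmForm A) (he : A e e ≠ 0)
    (hW : IsCurvatureLike W) (hQ : ∀ x y z w X Y, Q₄ A W x y z w X Y = 0)
    (hA1 : ∀ x y, A e e * A x y = A e x * A e y) (x y z w : V) :
    A e e * W x y z w = kn₄ A (fun u v => W e u v e) x y z w := by
  have hzero : ∀ x y, A e x = 0 → A x y = 0 := by
    intro x y hx
    have := hA1 x y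
    rw [hx, zero_mul] at this
    exact (mul_eq_zero.1 this).resolve_left he
  have hW' := hW.linearComb (hA.kn₄ (hW.isSymmForm e)) (A e e) (-1)
  have := hW'.eq_zero_of_orthogonal hA he ?_ ?_ ?_ x y z w
  · linarith
  · intro x y z hx hy hz
    rw [curvatureLike_apply_orthogonal_eq_zero hA he hW hQ x y z hx hy hz]
    simp [kn₄, hx, hy, hz, hzero]
  · intro x y hx hy
    simp [kn₄, hy, hW.self₁₂, hW.self₃₄, hzero x y hx]
  · intro x y z w hx hy hz hw
    rw [curvatureLike_mul_eq_of_orthogonal hA hW hQ x y z w hx hy hz hw]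
    simp [kn₄, hzero x _ hx, hzero y _ hy]

end KernelOfQ

end TensorAlg

namespace TensorAlg

variable {V : Type*} [AddCommGroup V] [Module ℝ V]

/-! ### Forms with `D · A = L Q(g, A)` -/

section Derivation

variable {g A B : V → V → ℝ} {D : V → V → V → V} {L : ℝ}

/-- `D · A = L Q(g, A)` for a symmetric form `A`. -/
def IsPseudoParallel {V : Type*} (D : V → V → V → V) (g : V → V → ℝ) (L : ℝ) (A : V → V → ℝ) : Prop :=
  ∀ x y X Y, A (D X Y x) y + A x (D X Y y) =
    L * (g Y x * A X y - g X x * A Y y + (g Y y * A x X - g X y * A x Y))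

/-- `D(X, Y)` and `L (X ∧_g Y)` act as derivations; they agree on both factors, hence on the
product. -/
theorem IsPseudoParallel.dot_kn₄ {V : Type*} {g A B : V → V → ℝ} {D : V → V → V → V} {L : ℝ}
    (hA : IsPseudoParallel D g L A) (hB : IsPseudoParallel D g L B)
    (x y z w X Y : V) :
    dot₄ D (kn₄ A B) x y z w X Y = L * Q₄ g (kn₄ A B) x y z w X Y := by
  simp only [dot₄, Q₄, kn₄]
  linear_combination -B y z * hA x w X Y - A x w * hB y z X Y - B x w * hA y z X Y
    - A y z * hB x w X Y + B y w * hA x z X Y + A x z * hB y w X Y + B x z * hA y w X Y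
    + A y w * hB x z X Y

theorem isPseudoParallel_self (hg : IsSymmForm g)
    (hD : ∀ x y X Y, g (D X Y x) y + g x (D X Y y) = 0) : IsPseudoParallel D g L g := by
  intro x y X Y
  rw [hD, hg.symm X y, hg.symm x X, hg.symm Y y, hg.symm x Y]
  ring

theorem IsPseudoParallel.linearComb {V : Type*} {g A B : V → V → ℝ} {D : V → V → V → V} {L : ℝ}
    (hA : IsPseudoParallel D g L A)
    (hB : IsPseudoParallel D g L B) (r s : ℝ) :
    IsPseudoParallel D g L fun x y => r * A x y + s * B x y := by
  intro x y X Y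
  linear_combination r * hA x y X Y + s * hB x y X Y

theorem dot_eq_of_eq_kn₄ {V : Type*} {g A B : V → V → ℝ} {D : V → V → V → V} {L : ℝ}
    {C : V → V → V → V → ℝ} (hA : IsPseudoParallel D g L A)
    (hB : IsPseudoParallel D g L B) {r s t : ℝ}
    (hC : ∀ x y z w, C x y z w = r * kn₄ A A x y z w + s * kn₄ B A x y z w + t * kn₄ B B x y z w)
    (x y z w X Y : V) : dot₄ D C x y z w X Y = L * Q₄ g C x y z w X Y := by
  have h1 := hA.dot_kn₄ hA x y z w X Y
  have h2 := hB.dot_kn₄ hA x y z w X Y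
  have h3 := hB.dot_kn₄ hB x y z w X Y
  simp only [dot₄, Q₄, hC] at h1 h2 h3 ⊢
  linear_combination r * h1 + s * h2 + t * h3

end Derivation

/-- A `g`-orthogonal basis `b`, with `c i = 1 / g (b i) (b i)`. -/
structure IsFrame {ι : Type*} [Fintype ι] (g : V → V → ℝ) (b : ι → V) (c : ι → ℝ) : Prop where
  expand : ∀ v, ∑ i, (c i * g (b i) v) • b i = v
  sum_self : ∑ i, c i * g (b i) (b i) = Fintype.card ι
  ortho : ∀ i j, i ≠ j → g (b i) (b j) = 0
  self_ne_zero : ∀ i, g (b i) (b i) ≠ 0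

/-! ### Contractions in an orthogonal frame -/

section Trace

variable {ι : Type*} [Fintype ι] {g A B : V → V → ℝ} {b : ι → V} {c : ι → ℝ}

/-- The trace of a form with respect to a frame. -/
def frameTrace {V : Type*} (b : ι → V) (c : ι → ℝ) (A : V → V → ℝ) : ℝ := ∑ i, c i * A (b i) (b i)

theorem IsFrame.sum_mul (hf : IsFrame g b c) (hA : IsSymmForm A) (y z : V) :
    ∑ i, c i * (g (b i) y * A (b i) z) = A y z := by
  have h := congrArg (hA.toLin z) (hf.expand y)
  rw [map_sum] at h
  simp only [map_smul, smul_eq_mul] at h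
  change _ = A y z at h
  rw [← h]
  refine Finset.sum_congr rfl fun i _ => ?_
  rw [mul_assoc]; rfl

theorem IsFrame.ext (hf : IsFrame g b c) (hg : IsSymmForm g) {u v : V}
    (h : ∀ x, g u x = g v x) : u = v := by
  rw [← hf.expand u, ← hf.expand v]
  simp_rw [hg.symm (b _), h]

theorem sum_kn₄ {V : Type*} {A B : V → V → ℝ} {b : ι → V} (y z : V) : ∑ i, c i * kn₄ A B (b i) y z (b i) =
    frameTrace b c A * B y z + A y z * frameTrace b c B
      - ∑ i, c i * (A (b i) z * B y (b i)) - ∑ i, c i * (A y (b i) * B (b i) z) := by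
  simp only [frameTrace, Finset.sum_mul, Finset.mul_sum, ← Finset.sum_add_distrib,
    ← Finset.sum_sub_distrib, kn₄]
  refine Finset.sum_congr rfl fun i _ => ?_
  ring

theorem IsFrame.sum_kn₄_self (hf : IsFrame g b c) (hg : IsSymmForm g) (hA : IsSymmForm A)
    (y z : V) : ∑ i, c i * kn₄ g A (b i) y z (b i) =
      (Fintype.card ι - 2) * A y z + frameTrace b c A * g y z := by
  rw [sum_kn₄]
  have h1 := hf.sum_mul hA z y
  have h2 := hf.sum_mul hA y z
  simp_rw [hA.symm y (b _), h1, hg.symm y (b _), h2]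
  rw [hA.symm z y, frameTrace, hf.sum_self]
  ring

end Trace

/-! ### The rank-one case -/

section RankOne

variable {ι : Type*} [Fintype ι] {g A H : V → V → ℝ} {b : ι → V} {c : ι → ℝ} {e U : V}
  {C : V → V → V → V → ℝ}

/-- If `a A = w ⊗ w` with `w = A e` dual to `U`, this is the Ricci contraction of `A ∧ H`. -/
theorem IsFrame.sum_kn₄_rank_one (hf : IsFrame g b c) (hA : IsSymmForm A)
    (hH : IsSymmForm H) (hA1 : ∀ x y, A e e * A x y = A e x * A e y)
    (hU : ∀ x, g U x = A e x) (hg : IsSymmForm g) (y z : V) :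
    A e e * ∑ i, c i * kn₄ A H (b i) y z (b i) =
      A e U * H y z + A e e * A y z * frameTrace b c H - A e z * H U y - A e y * H U z := by
  rw [sum_kn₄]
  have htr : A e e * frameTrace b c A = A e U := by
    have := hf.sum_mul hA U e
    rw [hA.symm e U, ← this, frameTrace, Finset.mul_sum]
    refine Finset.sum_congr rfl fun i _ => ?_
    rw [hg.symm, hU, hA.symm (b i) e]
    linear_combination c i * hA1 (b i) (b i)
  have hs : ∀ y z, A e e * ∑ i, c i * (A (b i) z * H y (b i)) = A e z * H U y := by
    intro y z
    rw [← hf.sum_mul hH U y, Finset.mul_sum, Finset.mul_sum]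
    refine Finset.sum_congr rfl fun i _ => ?_
    rw [hg.symm, hU, hH.symm y]
    linear_combination c i * H (b i) y * hA1 (b i) z
  have h1 := hs y z
  have h2 := hs z y
  have h3 : ∑ i, c i * (A y (b i) * H (b i) z) = ∑ i, c i * (A (b i) y * H z (b i)) := by
    refine Finset.sum_congr rfl fun i _ => ?_
    rw [hA.symm y, hH.symm z]
  rw [h3]
  linear_combination htr * H y z - h1 - h2

/-- The vanishing contraction of `C` is tested in two ways: at `(e, U)` and by a second trace. -/
theorem IsFrame.coeff_eq_zero_of_traceless (hf : IsFrame g b c) (hn : 3 ≤ Fintype.card ι)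
    (hg : IsSymmForm g) (hA : IsSymmForm A) (hH : IsSymmForm H) (he : A e e ≠ 0)
    (hA1 : ∀ x y, A e e * A x y = A e x * A e y) (hU : ∀ x, g U x = A e x)
    (hHe : ∀ x, H e x = 0) {β γ : ℝ}
    (hC : ∀ x y z w, A e e * C x y z w =
      A e e * β * kn₄ g A x y z w + A e e * γ * kn₄ g g x y z w + kn₄ A H x y z w)
    (htr : ∀ y z, ∑ i, c i * C (b i) y z (b i) = 0) : γ = 0 := by
  have hn' : (3 : ℝ) ≤ (Fintype.card ι : ℝ) := by exact_mod_cast hn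
  set n : ℝ := (Fintype.card ι : ℝ)
  have htrA : A e e * frameTrace b c A = A e U := by
    have := hf.sum_mul hA U e
    rw [hA.symm e U, ← this, frameTrace, Finset.mul_sum]
    refine Finset.sum_congr rfl fun i _ => ?_
    rw [hg.symm, hU, hA.symm (b i) e]
    linear_combination c i * hA1 (b i) (b i)
  have htrg : frameTrace b c g = n := hf.sum_self
  have E : ∀ y z, A e e * (A e e * β * ((n - 2) * A y z + frameTrace b c A * g y z)
      + A e e * γ * ((n - 2) * g y z + frameTrace b c g * g y z)) +
      (A e U * H y z + A e e * A y z * frameTrace b c H - A e z * H U y - A e y * H U z) = 0 := by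
    intro y z
    rw [← hf.sum_kn₄_self hg hA, ← hf.sum_kn₄_self hg hg,
      ← hf.sum_kn₄_rank_one hA hH hA1 hU hg, ← mul_add, ← mul_zero (A e e)]
    congr 1
    rw [← mul_zero (A e e), ← htr y z, Finset.mul_sum, Finset.mul_sum, Finset.mul_sum,
      ← Finset.sum_add_distrib, ← Finset.sum_add_distrib]
    refine Finset.sum_congr rfl fun i _ => ?_
    linear_combination -c i * hC (b i) y z (b i)
  have hgeU : g e U = A e e := by rw [hg.symm, hU]
  have E1 := E e U
  rw [hHe, hgeU, hH.symm U e, hHe, htrg] at E1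
  have E2 : ∑ i, c i * (A e e * (A e e * β * ((n - 2) * A (b i) (b i) +
      frameTrace b c A * g (b i) (b i))
      + A e e * γ * ((n - 2) * g (b i) (b i) + frameTrace b c g * g (b i) (b i))) +
      (A e U * H (b i) (b i) + A e e * A (b i) (b i) * frameTrace b c H - A e (b i) * H U (b i)
        - A e (b i) * H U (b i))) = 0 :=
    Finset.sum_eq_zero fun i _ => by rw [E, mul_zero]
  have hHU : ∑ i, c i * (A e (b i) * H U (b i)) = H U U := by
    rw [← hf.sum_mul hH U U]
    refine Finset.sum_congr rfl fun i _ => ?_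
    rw [hg.symm, hU, hH.symm U]
  have hsum : ∀ (p q r t : ℝ) (f₁ f₂ f₃ f₄ : ι → ℝ),
      ∑ i, (p * f₁ i + q * f₂ i + r * f₃ i + t * f₄ i) =
        p * ∑ i, f₁ i + q * ∑ i, f₂ i + r * ∑ i, f₃ i + t * ∑ i, f₄ i := by
    intro p q r t f₁ f₂ f₃ f₄
    simp only [Finset.sum_add_distrib, Finset.mul_sum]
  have E3 := hsum (A e e * (A e e * β * (n - 2)) + A e e * frameTrace b c H)
    (A e e * (A e e * β * frameTrace b c A + A e e * γ * (n - 2 + frameTrace b c g))) (A e U) (-2)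
    (fun i => c i * A (b i) (b i)) (fun i => c i * g (b i) (b i)) (fun i => c i * H (b i) (b i))
    (fun i => c i * (A e (b i) * H U (b i)))
  rw [hHU, ← frameTrace, ← frameTrace, ← frameTrace, show (∑ i, _ : ℝ) = 0 from
    (Finset.sum_congr rfl fun i _ => by ring).trans E2] at E3
  rw [htrg] at E3
  rw [← htrA] at E1 E3
  -- `A(e, e)` times the full trace minus twice the value at `(e, U)`: the terms in `β`, in the
  -- trace of `H` and in `H(U, U)` all cancel.
  have h0 : γ * (A e e ^ 3 * ((2 * n - 2) * (n - 2))) = 0 := by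
    linear_combination -A e e * E3 - 2 * E1
  refine (mul_eq_zero.1 h0).resolve_right (mul_ne_zero (pow_ne_zero _ he) ?_)
  exact mul_ne_zero (by linarith) (by linarith)

/-- Multiply the contraction at `(y, z)` by `A e x`, that at `(x, z)` by `A e y`, and subtract: the
trace of `H` drops out because `A` has rank one, and the rest is a multiple of `C x y z U`. -/
theorem IsFrame.apply_dual_eq_zero (hf : IsFrame g b c) (hg : IsSymmForm g)
    (hA : IsSymmForm A) (hH : IsSymmForm H) (he : A e e ≠ 0)
    (hA1 : ∀ x y, A e e * A x y = A e x * A e y) (hU : ∀ x, g U x = A e x)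
    (hC : ∀ x y z w, A e e * C x y z w = kn₄ A H x y z w)
    (htr : ∀ y z, ∑ i, c i * C (b i) y z (b i) = 0) (x y z : V) : C x y z U = 0 := by
  have E : ∀ y z, A e U * H y z + A e e * A y z * frameTrace b c H - A e z * H U y
      - A e y * H U z = 0 := by
    intro y z
    rw [← hf.sum_kn₄_rank_one hA hH hA1 hU hg, ← mul_zero (A e e)]
    congr 1
    rw [← mul_zero (A e e), ← htr y z, Finset.mul_sum]
    refine Finset.sum_congr rfl fun i _ => ?_
    linear_combination -c i * hC (b i) y z (b i)
  have h1 := E y z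
  have h2 := E x z
  have h3 := hC x y z U
  simp only [kn₄] at h3
  have h0 : A e e ^ 2 * C x y z U = 0 := by
    rw [hH.symm U y, hH.symm U z] at h1
    rw [hH.symm U x, hH.symm U z] at h2
    linear_combination A e e * h3 + A e x * h1 - A e y * h2 + H y z * hA1 x U + H x U * hA1 y z
      - H y U * hA1 x z - H x z * hA1 y U - A e x * frameTrace b c H * hA1 y z
      + A e y * frameTrace b c H * hA1 x z
  exact (mul_eq_zero.1 h0).resolve_left (pow_ne_zero _ he)

theorem IsFrame.exists_dual (hf : IsFrame g b c) (hg : IsSymmForm g) (hA : IsSymmForm A) (e : V) :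
    ∃ U, ∀ x, g U x = A e x := by
  refine ⟨∑ i, (c i * A e (b i)) • b i, fun x => ?_⟩
  have h : g (∑ i, (c i * A e (b i)) • b i) x = ∑ i, c i * A e (b i) * g (b i) x := by
    change hg.toLin x _ = _
    rw [map_sum]
    refine Finset.sum_congr rfl fun i _ => ?_
    rw [map_smul, smul_eq_mul]; rfl
  rw [h, hA.symm e x, ← hf.sum_mul hA x e]
  refine Finset.sum_congr rfl fun i _ => ?_
  rw [hA.symm e]; ring

variable {D : V → V → V → V} {L : ℝ}

/-- For `A` of rank one the condition descends to the covector `A(e, ·)`; skewness of `D(X, Y)` then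
carries it over to the dual vector `U`. -/
theorem IsFrame.apply_dual_of_isPseudoParallel (hf : IsFrame g b c) (hg : IsSymmForm g)
    (hA : IsSymmForm A) (he : A e e ≠ 0) (hA1 : ∀ x y, A e e * A x y = A e x * A e y)
    (hU : ∀ x, g U x = A e x) (hD : ∀ x y X Y, g (D X Y x) y + g x (D X Y y) = 0)
    (hp : IsPseudoParallel D g L A) (X Y : V) :
    D X Y U = (L * A e Y) • X - (L * A e X) • Y := by
  have key : ∀ v, A e (D X Y v) = L * (g Y v * A e X - g X v * A e Y) := by
    have h0 : A e (D X Y e) = L * (g Y e * A e X - g X e * A e Y) := by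
      have := hp e e X Y
      rw [hA.symm _ e, hA.symm X e, hA.symm Y e] at this
      linarith
    intro v
    have h1 := hp v e X Y
    rw [hA.symm (D X Y v) e, hA.symm v X, hA.symm v Y, hA.symm X e, hA.symm Y e] at h1
    have h2 : A e e * A v (D X Y e) = A e e * (L * (g Y e * A X v - g X e * A Y v)) := by
      linear_combination hA1 v (D X Y e) + A e v * h0 - L * g Y e * hA1 X v + L * g X e * hA1 Y v
    have h3 := mul_left_cancel₀ he h2
    linear_combination h1 - h3
  refine hf.ext hg fun x => ?_
  rw [hg.sub_left, hg.smul_left, hg.smul_left]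
  have h1 := hD U x X Y
  rw [hU, key, hg.symm Y, hg.symm X] at h1
  rw [hg.symm X, hg.symm Y]
  linarith

/-- If `D · C = τ Q(g, C)` and `D · A = L Q(g, A)` for a form `A` of rank one whose kernel vector
annihilates `C`, then `τ = L` or `C = 0`. -/
theorem dot_eq_of_rank_one (hf : IsFrame g b c) (hg : IsSymmForm g) (hA : IsSymmForm A)
    (hC : IsCurvatureLike C) (he : A e e ≠ 0) (hA1 : ∀ x y, A e e * A x y = A e x * A e y)
    (hU : ∀ x, g U x = A e x) (hD : ∀ x y X Y, g (D X Y x) y + g x (D X Y y) = 0)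
    (hp : IsPseudoParallel D g L A) (hCU : ∀ x y z, C x y z U = 0) {τ : ℝ}
    (hDC : ∀ x y z w X Y, dot₄ D C x y z w X Y = τ * Q₄ g C x y z w X Y) (x y z w X Y : V) :
    dot₄ D C x y z w X Y = L * Q₄ g C x y z w X Y := by
  by_cases hτ : τ = L
  · rw [hDC, hτ]
  -- With `U` in the last slot only the terms in which `U` itself is moved survive; their two sides
  -- differ by the factor `τ - L`.
  have h1 : ∀ x y z X Y, A e Y * C x y z X = A e X * C x y z Y := by
    intro x y z X Y
    have h := hDC x y z U X Y
    simp only [dot₄, Q₄, hCU] at h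
    rw [hf.apply_dual_of_isPseudoParallel hg hA he hA1 hU hD hp, sub_eq_add_neg, hC.add₄,
      ← neg_smul, hC.smul₄, hC.smul₄, hg.symm Y U, hg.symm X U, hU, hU] at h
    have h2 : (τ - L) * (A e Y * C x y z X - A e X * C x y z Y) = 0 := by linear_combination h
    linarith [(mul_eq_zero.1 h2).resolve_left (sub_ne_zero.2 hτ)]
  have h2 : ∀ x y w, C x y e w = 0 := by
    intro x y w
    have := h1 x y e w e
    rw [hC.self₃₄, mul_zero] at this
    exact (mul_eq_zero.1 this).resolve_left he
  have h3 : ∀ x y z w, C x y z w = 0 := by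
    intro x y z w
    have := h1 x y z w e
    rw [hC.skew₃₄ x y z e, h2, neg_zero, mul_zero] at this
    exact (mul_eq_zero.1 this).resolve_left he
  simp [dot₄, Q₄, h3]

end RankOne

/-! ### The two cases `L₂ = 1` and `L₂ ≠ 1` -/

section Main

variable {ι : Type*} [Fintype ι] {g S : V → V → ℝ} {b : ι → V} {c : ι → ℝ}
  {C : V → V → V → V → ℝ} {D : V → V → V → V} {L l α γ : ℝ}

/-- The exchange rule puts every term under `Q(g, ·)`, and two orthogonal frame vectors supply the
rank needed for the kernel of `Q(g, ·)`. -/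
theorem IsFrame.dot_eq_of_proportional (hf : IsFrame g b c) (hn : 3 ≤ Fintype.card ι)
    (hg : IsSymmForm g) (hS : IsSymmForm S) (hC : IsCurvatureLike C)
    (hgp : IsPseudoParallel D g L g) (hSp : IsPseudoParallel D g L S) (hl : l ≠ 0)
    (hQ : ∀ x y z w X Y, l * Q₄ g C x y z w X Y + α * Q₄ S (kn₄ g S) x y z w X Y
      + γ * Q₄ S (kn₄ g g) x y z w X Y = 0) (x y z w X Y : V) :
    dot₄ D C x y z w X Y = L * Q₄ g C x y z w X Y := by
  obtain ⟨i, j, hij⟩ := Fintype.exists_pair_of_one_lt_card (by omega : 1 < Fintype.card ι)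
  have hW := (hC.linearComb (hS.kn₄ hS) l (-(α / 2))).linearComb (hg.kn₄ hS) 1 (-2 * γ)
  obtain ⟨r, hr⟩ := curvatureLike_eq_kn_self hg (hf.self_ne_zero i) hW (by
    intro x y z w X Y
    have h1 := hQ x y z w X Y
    have h2 := Q₄_kn₄ hS hg x y z w X Y
    have h3 := Q₄_kn₄ hg hS x y z w X Y
    rw [kn₄_comm S g] at h3
    simp only [Q₄] at h1 h2 h3 ⊢
    linear_combination h1 - α * h2 - 2 * γ * h3) (hf.ortho i j hij) (hf.self_ne_zero j)
  refine dot_eq_of_eq_kn₄ hSp hgp (r := α / 2 / l) (s := 2 * γ / l) (t := r / l) ?_ x y z w X Y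
  intro x y z w
  have := hr x y z w
  field_simp
  linear_combination 2 * this

theorem IsFrame.dot_eq_of_Q₄_eq (hf : IsFrame g b c) (hn : 3 ≤ Fintype.card ι)
    (hg : IsSymmForm g) (hS : IsSymmForm S) (hC : IsCurvatureLike C)
    (hD : ∀ x y X Y, g (D X Y x) y + g x (D X Y y) = 0)
    (hSp : IsPseudoParallel D g L S)
    (htr : ∀ y z, ∑ i, c i * C (b i) y z (b i) = 0)
    (hSg : ∀ r : ℝ, ∃ x y, S x y ≠ r * g x y)
    (hQ : ∀ x y z w X Y, Q₄ S C x y z w X Y = l * Q₄ g C x y z w X Y +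
      α * Q₄ S (kn₄ g S) x y z w X Y + γ * Q₄ S (kn₄ g g) x y z w X Y) {L₂ : ℝ}
    (hDC : ∀ x y z w X Y, dot₄ D C x y z w X Y = L₂ * Q₄ S C x y z w X Y) (x y z w X Y : V) :
    dot₄ D C x y z w X Y = L * Q₄ g C x y z w X Y := by
  have hgp := isPseudoParallel_self (L := L) hg hD
  obtain ⟨A, hAdef⟩ : ∃ A : V → V → ℝ, A = fun x y => 1 * S x y + (-l) * g x y := ⟨_, rfl⟩
  have hA : IsSymmForm A := hAdef ▸ hS.linearComb hg 1 (-l)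
  have hAp : IsPseudoParallel D g L A := hAdef ▸ hSp.linearComb hgp 1 (-l)
  have hSA : S = fun x y => A x y + l * g x y := by
    ext x y; rw [hAdef]; ring
  obtain ⟨e, he⟩ := hA.exists_self_ne_zero (by
    obtain ⟨x, y, hxy⟩ := hSg l
    refine ⟨x, y, fun h => hxy ?_⟩
    rw [hSA]; simp [h])
  have hW := (hC.linearComb (hg.kn₄ hA) 1 (-α)).linearComb (hg.kn₄ hg) 1 (-(α * l / 2 + γ))
  -- With `S = A + l g` the exchange rule gives `Q(S, g ∧ S) = Q(A, g ∧ A) + (l / 2) Q(A, g ∧ g)`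
  -- and `Q(S, g ∧ g) = Q(A, g ∧ g)`; hence the coefficient `α l / 2 + γ`.
  have hQW : ∀ x y z w X Y, Q₄ A (fun x y z w => 1 * (1 * C x y z w + -α * kn₄ g A x y z w) +
      -(α * l / 2 + γ) * kn₄ g g x y z w) x y z w X Y = 0 := by
    intro x y z w X Y
    have h1 := hQ x y z w X Y
    have h2 := Q₄_kn₄ hA hg x y z w X Y
    have h3 := Q₄_kn₄ hg hA x y z w X Y
    have h4 := Q₄_kn₄ hS hg x y z w X Y
    have h5 := Q₄_kn₄_self hg x y z w X Y
    rw [h4, hSA] at h1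
    rw [kn₄_comm A g] at h3
    have h6 : Q₄ g (kn₄ (fun x y => A x y + l * g x y) fun x y => A x y + l * g x y) x y z w X Y
        = Q₄ g (kn₄ A A) x y z w X Y + 2 * l * Q₄ g (kn₄ g A) x y z w X Y := by
      have : Q₄ g (kn₄ (fun x y => A x y + l * g x y) fun x y => A x y + l * g x y) x y z w X Y
        = Q₄ g (kn₄ A A) x y z w X Y + 2 * l * Q₄ g (kn₄ g A) x y z w X Y
          + l ^ 2 * Q₄ g (kn₄ g g) x y z w X Y := by
        simp only [Q₄, kn₄]; ring
      rw [this, h5]; ring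
    have h7 : ∀ T, Q₄ (fun x y => A x y + l * g x y) T x y z w X Y =
        Q₄ A T x y z w X Y + l * Q₄ g T x y z w X Y := by
      intro T; simp only [Q₄]; ring
    rw [h6, h7, h7, h5] at h1
    have h8 : Q₄ A (fun x y z w => 1 * (1 * C x y z w + -α * kn₄ g A x y z w) +
        -(α * l / 2 + γ) * kn₄ g g x y z w) x y z w X Y = Q₄ A C x y z w X Y
        - α * Q₄ A (kn₄ g A) x y z w X Y - (α * l / 2 + γ) * Q₄ A (kn₄ g g) x y z w X Y := by
      simp only [Q₄]; ring
    rw [h8]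
    linear_combination h1 - α * h2 - α * l * h3
  by_cases hf2 : ∃ f, A e f = 0 ∧ A f f ≠ 0
  · obtain ⟨f, hef, hff⟩ := hf2
    obtain ⟨r, hr⟩ := curvatureLike_eq_kn_self hA he hW hQW hef hff
    refine dot_eq_of_eq_kn₄ hAp hgp (r := r) (s := α) (t := α * l / 2 + γ) ?_ x y z w X Y
    intro x y z w
    linear_combination hr x y z w
  push Not at hf2
  have hA1 := hA.mul_self_eq_of_orthogonal he hf2
  obtain ⟨U, hU⟩ := hf.exists_dual hg hA e
  have hkn := curvatureLike_eq_kn_of_rank_one hA he hW hQW hA1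
  have hH := hW.isSymmForm e
  have hγ := hf.coeff_eq_zero_of_traceless hn hg hA hH he hA1 hU
    (fun x => hW.self₁₂ e x e) (β := α) (γ := α * l / 2 + γ) (C := C)
    (fun x y z w => by linear_combination hkn x y z w) htr
  rw [hγ] at hkn hH
  -- The remaining term `α g ∧ A` is absorbed into `H`, so that `A(e, e) C = A ∧ H'`.
  have hH' := hH.linearComb hg 1 (A e e * α)
  have hCU := hf.apply_dual_eq_zero hg hA hH' he hA1 hU (C := C) (fun x y z w => by
    have h1 := hkn x y z w
    simp only [kn₄] at h1 ⊢
    linear_combination h1) htr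
  -- In rank one `A ∧ A = 0`, so `Q(A, g ∧ A) = 0` by the exchange rule and therefore `Q(A, C) = 0`.
  -- Thus `Q(S, C) = l Q(g, C)`, whence `τ = L₂ l`.
  refine dot_eq_of_rank_one hf hg hA hC he hA1 hU hD hAp hCU (τ := L₂ * l) ?_ x y z w X Y
  intro x y z w X Y
  have h1 := hQW x y z w X Y
  have h2 := Q₄_kn₄ hA hg x y z w X Y
  have h3 : ∀ x y z w, kn₄ A A x y z w = 0 := by
    intro x y z w
    have : A e e ^ 2 * kn₄ A A x y z w = 0 := by
      simp only [kn₄]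
      linear_combination 2 * A e e * A y z * hA1 x w + 2 * A e x * A e w * hA1 y z
        - 2 * A e e * A y w * hA1 x z - 2 * A e x * A e z * hA1 y w
    exact (mul_eq_zero.1 this).resolve_left (pow_ne_zero _ he)
  rw [hγ] at h1
  rw [hDC, hSA]
  simp only [Q₄, h3] at h1 h2 ⊢
  linear_combination L₂ * h1 + L₂ * α * h2

end Main



end TensorAlg

/-! ### Passage to tensors on `Fin k → V` and the pointwise theorem -/

namespace TensorAlg

variable {V : Type*} [AddCommGroup V] [Module ℝ V]

theorem dot_apply_four (D : V →ₗ[ℝ] V →ₗ[ℝ] V →ₗ[ℝ] V) (T : V → V → V → V → ℝ)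
    (v : Fin 4 → V) (X Y : V) :
    dot D (fun v => T (v 0) (v 1) (v 2) (v 3)) v X Y =
      dot₄ (fun X Y Z => D X Y Z) T (v 0) (v 1) (v 2) (v 3) X Y := by
  simp [dot, act, Fin.sum_univ_four, dot₄, Function.update_apply]

theorem Q_apply_four (A : V →ₗ[ℝ] V →ₗ[ℝ] ℝ) {T : V → V → V → V → ℝ} (hT : IsCurvatureLike T)
    (v : Fin 4 → V) (X Y : V) :
    Q A (fun v => T (v 0) (v 1) (v 2) (v 3)) v X Y =
      Q₄ (fun x y => A x y) T (v 0) (v 1) (v 2) (v 3) X Y := by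
  simp [Q, act, Fin.sum_univ_four, Q₄, Function.update_apply, wedgeEnd, sub_eq_add_neg,
    ← neg_smul, hT.add₁, hT.add₂, hT.add₃, hT.add₄, hT.smul₁, hT.smul₂, hT.smul₃, hT.smul₄]

theorem isPseudoParallel_of_dot_eq {D : V →ₗ[ℝ] V →ₗ[ℝ] V →ₗ[ℝ] V} {g A : V →ₗ[ℝ] V →ₗ[ℝ] ℝ}
    {L : ℝ} (h : dot D (tensor₂ A) = L • Q g (tensor₂ A)) :
    IsPseudoParallel (fun X Y Z => D X Y Z) (fun x y => g x y) L fun x y => A x y := by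
  intro x y X Y
  have := congrFun (congrFun (congrFun h ![x, y]) X) Y
  simp [dot, Q, act, Fin.sum_univ_two, tensor₂, wedgeEnd, Function.update_apply] at this
  linarith

theorem exists_isFrame [FiniteDimensional ℝ V] {g : LinearMap.BilinForm ℝ V} (hg : g.Nondegenerate)
    (hgs : ∀ x y, g x y = g y x) :
    ∃ (b : Module.Basis (Fin (Module.finrank ℝ V)) ℝ V) (c : Fin (Module.finrank ℝ V) → ℝ),
      IsFrame (fun x y => g x y) b c := by
  obtain ⟨b, hb⟩ := LinearMap.BilinForm.exists_orthogonal_basis (B := g) ⟨hgs⟩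
  have hne : ∀ i, g (b i) (b i) ≠ 0 := fun i =>
    hb.not_isOrtho_basis_self_of_separatingLeft hg.1 i
  have hortho : ∀ i j, i ≠ j → g (b i) (b j) = 0 := fun i j hij => hb hij
  refine ⟨b, fun i => (g (b i) (b i))⁻¹, ⟨fun v => ?_, ?_, hortho, hne⟩⟩
  · conv_rhs => rw [← b.sum_repr v]
    refine Finset.sum_congr rfl fun i _ => ?_
    congr 1
    have : g (b i) v = b.repr v i * g (b i) (b i) := by
      conv_lhs => rw [← b.sum_repr v]
      rw [map_sum, Finset.sum_eq_single i]
      · simp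
      · intro j _ hji; simp [hortho i j hji.symm]
      · simp
    rw [this, mul_comm, mul_assoc, mul_inv_cancel₀ (hne i), mul_one]
  · simp [inv_mul_cancel₀ (hne _)]

theorem trace_eq_sum_frame {ι : Type*} [Fintype ι] {g : LinearMap.BilinForm ℝ V}
    (hgs : ∀ x y, g x y = g y x) {b : Module.Basis ι ℝ V} {c : ι → ℝ}
    (hf : IsFrame (fun x y => g x y) b c) (f : V →ₗ[ℝ] V) :
    LinearMap.trace ℝ V f = ∑ i, c i * g (f (b i)) (b i) := by
  classical
  rw [LinearMap.trace_eq_matrix_trace ℝ b, Matrix.trace]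
  refine Finset.sum_congr rfl fun i _ => ?_
  rw [Matrix.diag_apply, LinearMap.toMatrix_apply]
  have h := congrArg (fun v => b.repr v i) (hf.expand (f (b i)))
  simp [Finsupp.single_apply] at h
  rw [← h, hgs]

theorem dot_lower_eq_of_weyl [FiniteDimensional ℝ V] (hn : 3 ≤ Module.finrank ℝ V) {g : LinearMap.BilinForm ℝ V}
    (hg : g.Nondegenerate) (hgs : ∀ x y, g x y = g y x) {R : V →ₗ[ℝ] V →ₗ[ℝ] V →ₗ[ℝ] V}
    (hR₁₂ : ∀ x y z, R x y z = -R y x z)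
    (hR₃₄ : ∀ x y z w, g (R x y z) w = -g (R x y w) z)
    (hRb : ∀ x y z, R x y z + R y z x + R z x y = 0) {L L₁ L₂ : ℝ}
    (hU : ricci R - (traceForm g hg (ricci R) / Module.finrank ℝ V) • g ≠ 0)
    (hS : dot R (tensor₂ (ricci R)) = L • Q g (tensor₂ (ricci R)))
    {C : (Fin 4 → V) → ℝ}
    (hC : C = lower g R - (1 / ((Module.finrank ℝ V : ℝ) - 2)) • kn g (ricci R) +
      (traceForm g hg (ricci R) / (2 * ((Module.finrank ℝ V : ℝ) - 1) *
        ((Module.finrank ℝ V : ℝ) - 2))) • kn g g)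
    (h₁ : dot R (lower g R) - Q (ricci R) (lower g R) = L₁ • Q g C)
    (h₂ : dot R C = L₂ • Q (ricci R) C) (hL : L₁ ≠ 0 ∨ L₂ ≠ 1) :
    dot R (lower g R) = L • Q g (lower g R) := by
  obtain ⟨b, c, hf⟩ := exists_isFrame hg hgs
  have hn' : (3 : ℝ) ≤ Module.finrank ℝ V := by exact_mod_cast hn
  set n : ℝ := (Module.finrank ℝ V : ℝ)
  set α : ℝ := 1 / (n - 2)
  set κ : ℝ := traceForm g hg (ricci R)
  set β : ℝ := κ / (2 * (n - 1) * (n - 2))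
  have hgf : IsSymmForm fun x y => g x y := LinearMap.isSymmForm hgs
  have hRc : IsCurvatureLike fun x y z w => g (R x y z) w :=
    ⟨by simp, by simp, fun x y z w => by rw [hR₁₂]; simp, hR₃₄, fun x y z w => by
      rw [← LinearMap.add_apply, ← map_add, ← LinearMap.add_apply, ← map_add, hRb]; simp⟩
  have hric : ∀ y z, ricci R y z = ∑ i, c i * g (R (b i) y z) (b i) := fun y z =>
    trace_eq_sum_frame hgs hf _
  have hSf : IsSymmForm fun x y => ricci R x y := LinearMap.isSymmForm fun y z => by
    rw [hric, hric]
    refine Finset.sum_congr rfl fun i _ => ?_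
    rw [(hRc.isSymmForm (b i)).symm y z]
  have hκ : κ = frameTrace b c fun x y => ricci R x y := by
    refine (trace_eq_sum_frame hgs hf _).trans (Finset.sum_congr rfl fun i _ => ?_)
    congr 1
    exact LinearMap.BilinForm.apply_toDual_symm_apply (hB := hg) ..
  have hα : α * (n - 2) = 1 := one_div_mul_cancel (by linarith)
  have hβ : β * (2 * (n - 1) * (n - 2)) = κ :=
    div_mul_cancel₀ _ (mul_ne_zero (mul_ne_zero two_ne_zero (by linarith)) (by linarith))
  have hcard : ((Fintype.card (Fin (Module.finrank ℝ V)) : ℕ) : ℝ) = n := by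
    rw [Fintype.card_fin]
  have hSp := isPseudoParallel_of_dot_eq hS
  obtain ⟨S, hSdef⟩ : ∃ S : V → V → ℝ, S = fun x y => ricci R x y := ⟨_, rfl⟩
  obtain ⟨G, hGdef⟩ : ∃ G : V → V → ℝ, G = fun x y => g x y := ⟨_, rfl⟩
  obtain ⟨R₄, hR₄def⟩ : ∃ R₄ : V → V → V → V → ℝ, R₄ = fun x y z w => g (R x y z) w := ⟨_, rfl⟩
  obtain ⟨D, hDdef⟩ : ∃ D : V → V → V → V, D = fun X Y Z => R X Y Z := ⟨_, rfl⟩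
  obtain ⟨W, hWdef⟩ : ∃ W : V → V → V → V → ℝ, W = fun x y z w =>
    1 * (1 * R₄ x y z w + (-α) * kn₄ G S x y z w) + β * kn₄ G G x y z w := ⟨_, rfl⟩
  have hD : ∀ x y X Y, G (D X Y x) y + G x (D X Y y) = 0 := by
    intro x y X Y
    rw [hGdef, hDdef]
    change g (R X Y x) y + g x (R X Y y) = 0
    rw [hgs x, hR₃₄ X Y x y]; ring
  rw [← hSdef] at hSf hκ hSp
  rw [← hGdef] at hgf hf hSp
  rw [← hDdef] at hSp
  rw [← hR₄def] at hRc
  have hWc : IsCurvatureLike W := by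
    rw [hWdef]
    exact (hRc.linearComb (hgf.kn₄ hSf) 1 (-α)).linearComb (hgf.kn₄ hgf) 1 β
  have hCW : C = fun v => W (v 0) (v 1) (v 2) (v 3) := by
    rw [hC, hWdef, hR₄def, hGdef, hSdef]
    ext v
    simp only [Pi.add_apply, Pi.sub_apply, Pi.smul_apply, smul_eq_mul, kn, kn₄, lower]
    ring
  have hRR : lower g R = fun v => R₄ (v 0) (v 1) (v 2) (v 3) := by
    rw [hR₄def]; rfl
  rw [hRR] at h₁ ⊢
  rw [hCW] at h₁ h₂
  have e₁ : ∀ x y z w X Y, dot₄ D R₄ x y z w X Y - Q₄ S R₄ x y z w X Y =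
      L₁ * Q₄ G W x y z w X Y := by
    intro x y z w X Y
    have h := congrFun (congrFun (congrFun h₁ ![x, y, z, w]) X) Y
    simp only [Pi.sub_apply, Pi.smul_apply, smul_eq_mul] at h
    rw [dot_apply_four, Q_apply_four _ hRc, Q_apply_four _ hWc, ← hSdef, ← hGdef, ← hDdef] at h
    exact h
  have e₂ : ∀ x y z w X Y, dot₄ D W x y z w X Y = L₂ * Q₄ S W x y z w X Y := by
    intro x y z w X Y
    have h := congrFun (congrFun (congrFun h₂ ![x, y, z, w]) X) Y
    simp only [Pi.smul_apply, smul_eq_mul] at h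
    rw [dot_apply_four, Q_apply_four _ hWc, ← hSdef, ← hDdef] at h
    exact h
  have hgp := isPseudoParallel_self (L := L) hgf hD
  have hdotR : ∀ x y z w X Y, dot₄ D R₄ x y z w X Y = dot₄ D W x y z w X Y
      + α * (L * Q₄ G (kn₄ G S) x y z w X Y) - β * (L * Q₄ G (kn₄ G G) x y z w X Y) := by
    intro x y z w X Y
    rw [← hgp.dot_kn₄ hSp, ← hgp.dot_kn₄ hgp, hWdef]
    simp only [dot₄]
    ring
  have hQR : ∀ A x y z w X Y, Q₄ A R₄ x y z w X Y = Q₄ A W x y z w X Y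
      + α * Q₄ A (kn₄ G S) x y z w X Y - β * Q₄ A (kn₄ G G) x y z w X Y := by
    intro A x y z w X Y
    rw [hWdef]
    simp only [Q₄]
    ring
  -- Substitute `R = C + α g ∧ S - β g ∧ g` in the first hypothesis; `Q(g, g ∧ S) = -½ Q(S, g ∧ g)`
  -- produces the summand `α L / 2`.
  have key : ∀ x y z w X Y, (L₂ - 1) * Q₄ S W x y z w X Y = L₁ * Q₄ G W x y z w X Y
      + α * Q₄ S (kn₄ G S) x y z w X Y
      + (α * L / 2 - β) * Q₄ S (kn₄ G G) x y z w X Y := by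
    intro x y z w X Y
    have h := e₁ x y z w X Y
    have h3 := Q₄_kn₄ hgf hSf x y z w X Y
    rw [hdotR, hQR, e₂, Q₄_kn₄_self hgf] at h
    rw [kn₄_comm S G] at h3
    linear_combination h - α * L * h3
  have hmain : ∀ x y z w X Y, dot₄ D W x y z w X Y = L * Q₄ G W x y z w X Y := by
    by_cases hp : L₂ - 1 = 0
    · have hL₁ : L₁ ≠ 0 := hL.resolve_right fun h => h (by linarith)
      refine hf.dot_eq_of_proportional (by simpa using hn) hgf hSf hWc hgp hSp hL₁ (α := α)
        (γ := α * L / 2 - β) fun x y z w X Y => ?_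
      linear_combination Q₄ S W x y z w X Y * hp - key x y z w X Y
    · refine hf.dot_eq_of_Q₄_eq (by simpa using hn) hgf hSf hWc hD hSp ?_ ?_
        (l := L₁ / (L₂ - 1)) (α := α / (L₂ - 1)) (γ := (α * L / 2 - β) / (L₂ - 1)) ?_ e₂
      -- The Weyl tensor is traceless: the values of `α` and `β` cancel the Ricci contraction of
      -- `R`.
      · intro y z
        have h1 := hf.sum_kn₄_self hgf hSf y z
        have h2 := hf.sum_kn₄_self hgf hgf y z
        rw [hcard] at h1 h2
        rw [← hκ] at h1
        rw [show frameTrace b c G = n from hf.sum_self.trans hcard] at h2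
        have h3 : S y z = ∑ i, c i * R₄ (b i) y z (b i) := by
          rw [hSdef, hR₄def]; exact hric y z
        have h4 : ∑ i, c i * W (b i) y z (b i) = ∑ i, c i * R₄ (b i) y z (b i)
            - α * ∑ i, c i * kn₄ G S (b i) y z (b i) + β * ∑ i, c i * kn₄ G G (b i) y z (b i) := by
          simp only [Finset.mul_sum, ← Finset.sum_add_distrib, ← Finset.sum_sub_distrib, hWdef]
          exact Finset.sum_congr rfl fun i _ => by ring
        rw [h4, h1, h2, ← h3]
        linear_combination -S y z * hα + α * G y z * hβ - 2 * β * (n - 1) * G y z * hα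
      -- If `S = r g`, taking the trace gives `r = κ / n`, which is excluded on `U_S`.
      · by_contra! h
        obtain ⟨r, hr⟩ := h
        apply hU
        have hκr : κ = r * n := by
          rw [hκ, frameTrace, ← hcard, ← hf.sum_self, Finset.mul_sum]
          exact Finset.sum_congr rfl fun i _ => by rw [hr]; ring
        have : κ / n = r := by rw [hκr, mul_div_cancel_right₀ _ (by linarith)]
        rw [this]
        ext x y
        have := hr x y
        rw [hSdef, hGdef] at this
        simp [this]
      · intro x y z w X Y
        have := key x y z w X Y
        field_simp
        linear_combination 2 * this
  funext v X Y
  simp only [Pi.smul_apply, smul_eq_mul]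
  rw [dot_apply_four, Q_apply_four _ hRc, ← hDdef, ← hGdef, hdotR, hQR, hmain]
  ring

end TensorAlg

theorem proposition4p3
    {E : Type*} [NormedAddCommGroup E] [NormedSpace ℝ E] [FiniteDimensional ℝ E]
    (hn : 3 ≤ Module.finrank ℝ E)
    {M : Type*} [TopologicalSpace M] [T2Space M] [SecondCountableTopology M] [ConnectedSpace M]
    [ChartedSpace E M] [IsManifold 𝓘(ℝ, E) ∞ M]
    (g : SemiRiemannianMetric E M) (L_S L₁ L₂ : M → ℝ)
    -- `R · S = L_S Q(g, S)` on `U_S`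
    (hS : ∀ x ∈ g.US,
      TensorAlg.dot (g.curvature x) (TensorAlg.tensor₂ (g.ric x)) =
        L_S x • TensorAlg.Q (g.form x) (TensorAlg.tensor₂ (g.ric x)))
    -- `R · R - Q(S, R) = L₁ Q(g, C)`
    (h₁ : ∀ x, TensorAlg.dot (g.curvature x) (g.riemann x) - TensorAlg.Q (g.ric x) (g.riemann x) =
      L₁ x • TensorAlg.Q (g.form x) (g.weyl x))
    -- `R · C = L₂ Q(S, C)`
    (h₂ : ∀ x, TensorAlg.dot (g.curvature x) (g.weyl x) =
      L₂ x • TensorAlg.Q (g.ric x) (g.weyl x)) :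
    ∀ x ∈ g.US, (L₁ x ≠ 0 ∨ L₂ x ≠ 1) →
      TensorAlg.dot (g.curvature x) (g.riemann x) =
        L_S x • TensorAlg.Q (g.form x) (g.riemann x) := by
  intro x hx hL
  have : FiniteDimensional ℝ (TangentSpace 𝓘(ℝ, E) x) := inferInstanceAs (FiniteDimensional ℝ E)
  exact @TensorAlg.dot_lower_eq_of_weyl (TangentSpace 𝓘(ℝ, E) x) _ _ this hn _ (g.form_nondegenerate x)
    (g.symm x) _ (g.curvature_skew x) (g.inner_curvature_skew x) (g.curvature_bianchi x) _ _ _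
    hx (hS x hx) _ rfl (h₁ x) (h₂ x) hL
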